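/- All logarithms are to base 2. Let $\mathcal U,\mathcal V,\mathcal X$ be finite alphabets and $\mathcal H_B,\mathcal H_C$ finite-dimensional Hilbert spaces. For every $n\ge 1$ let $\mathcal N^{(n)}:x^n\mapsto\rho^{B^nC^n}_{x^n}$ ($x^n\in\mathcal X^n$) be an arbitrary classical-quantum broadcast channel, each $\rho^{B^nC^n}_{x^n}$ being a density operator on $\mathcal H_B^{\otimes n}\otimes\mathcal H_C^{\otimes n}$; let $p_{U^nV^n}$ be an arbitrary probability mass function on $\mathcal U^n\times\mathcal V^n$ and $f_n:\mathcal U^n\times\mathcal V^n\to\mathcal X^n$ an arbitrary function. Put $$\rho^{U^nV^nB^nC^n}=\sum_{(u^n,v^n)}p_{U^nV^n}(u^n,v^n)\,|u^n\rangle\langle u^n|\otimes|v^n\rangle\langle v^n|\otimes\rho^{B^nC^n}_{f_n(u^n,v^n)} .$$ Write the marginal on $U^nB^n$ as $\rho^{U^nB^n}=\sum_{u^n}p_{U^n}(u^n)|u^n\rangle\langle u^n|\otimes\rho^{B^n}_{u^n}$, with $\rho^{B^n}=\sum_{u^n}p_{U^n}(u^n)\rho^{B^n}_{u^n}$. For Hermitian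 operators $S,T$ let $\{S\succeq T\}$ be the projector onto the span of the eigenvectors of $S-T$ with nonnegative eigenvalues. The spectral inf quantum mutual information rate is $$\underline I[\mathbf U;\mathbf B]=\sup\Big\{\gamma\in\mathbb R:\ \lim_{n\to\infty}\sum_{u^n}p_{U^n}(u^n)\,\mathrm{Tr}\big[\{\rho^{B^n}_{u^n}\succeq 2^{n\gamma}\rho^{B^n}\}\,\rho^{B^n}_{u^n}\big]=1\Big\},$$ and $\underline I[\mathbf V;\mathbf C]$ is defined in the same way from the marginals on $V^nC^n$. The spectral sup classical mutual information rate is $$\overline I[\mathbf U;\mathbf V]=\inf\Big\{\lambda\in\mathbb R:\ \lim_{n\to\infty}\Pr\Big[\tfrac1n\log\tfrac{p_{U^nV^n}(U^n,V^n)}{p_{U^n}(U^n)\,p_{V^n}(V^n)}>\lambda\Big]=0\Big\},$$ where $(U^n,V^n)\sim p_{U^nV^n}$. Let $R_1,R_2$ be real numbers with $$R_1<\underline I[\mathbf U;\mathbf B],\qquad R_2<\underline I[\mathbf V;\mathbf C],\qquad R_1+R_2<\underline I[\mathbf U;\mathbf B]+\underline I[\mathbf V;\mathbf C]-\overline I[\mathbf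 U;\mathbf V].$$ Then $(R_1,R_2)$ is asymptotically achievable for $\{\mathcal N^{(n)}\}$: for every $n$ there are positive integers $M_1^{(n)},M_2^{(n)}$, an encoding function $F_n:[M_1^{(n)}]\times[M_2^{(n)}]\to\mathcal X^n$, a POVM $\{\mathcal T^{B^n}_{m_1}\}_{m_1\in[M_1^{(n)}]}$ on $\mathcal H_B^{\otimes n}$ and a POVM $\{\mathcal T^{C^n}_{m_2}\}_{m_2\in[M_2^{(n)}]}$ on $\mathcal H_C^{\otimes n}$ such that $$R_i\le\liminf_{n\to\infty}\tfrac1n\log M_i^{(n)}\quad(i=1,2)$$ and $$\lim_{n\to\infty}\frac1{M_1^{(n)}M_2^{(n)}}\sum_{m_1,m_2}\mathrm{Tr}\big[(\mathbb I-\mathcal T^{B^n}_{m_1}\otimes\mathcal T^{C^n}_{m_2})\,\mathcal N^{(n)}(F_n(m_1,m_2))\big]=0 .$$ -/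

import Mathlib

open Filter Topology
open scoped Kronecker ComplexOrder

noncomputable section

namespace CQBroadcast

/-! Finite-dimensional Hilbert spaces are given by a finite set of labels of an orthonormal basis, so
operators are complex matrices, tensor products are Kronecker products, and the tensor power of order
`n` of a space with basis labels `ℬ` has the basis labels `Fin n → ℬ`. Logarithms are to base 2. -/

/-- A density matrix. -/
def IsState {d : Type*} [Fintype d] (ρ : Matrix d d ℂ) : Prop :=
  ρ.PosSemidef ∧ ρ.trace = 1

/-- A positive operator valued measure with outcomes in `M`. -/
def IsPOVM {M d : Type*} [Fintype M] [Fintype d] [DecidableEq d] (T : M → Matrix d d ℂ) : Prop :=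
  (∀ m, (T m).PosSemidef) ∧ ∑ m, T m = 1

/-- The projector `{A ⪰ 0}` onto the sum of the eigenspaces of the Hermitian matrix `A` for
nonnegative eigenvalues. -/
def nonnegProj {d : Type*} [Fintype d] [DecidableEq d] (A : Matrix d d ℂ) : Matrix d d ℂ :=
  cfc (fun x : ℝ => if 0 ≤ x then (1 : ℝ) else 0) A

/-- The state `ρ^{UVBC} = ∑_{u,v} p(u,v) |u⟩⟨u| ⊗ |v⟩⟨v| ⊗ ρ^{BC}_{f(u,v)}`. -/
def jointState {U V X B C : Type*} [Fintype U] [Fintype V] [DecidableEq U] [DecidableEq V]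
    (p : U × V → ℝ) (f : U × V → X) (ρ : X → Matrix (B × C) (B × C) ℂ) :
    Matrix ((U × V) × (B × C)) ((U × V) × (B × C)) ℂ :=
  ∑ w : U × V, (p w : ℂ) •
    ((Matrix.single w.1 w.1 (1 : ℂ) ⊗ₖ Matrix.single w.2 w.2 (1 : ℂ)) ⊗ₖ ρ (f w))

/-- The marginal `ρ^{UB} = Tr_{VC} ρ^{UVBC}`. -/
def marginalUB {U V B C : Type*} [Fintype V] [Fintype C]
    (ω : Matrix ((U × V) × (B × C)) ((U × V) × (B × C)) ℂ) : Matrix (U × B) (U × B) ℂ :=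
  Matrix.of fun i j => ∑ v, ∑ c, ω ((i.1, v), (i.2, c)) ((j.1, v), (j.2, c))

/-- The marginal `ρ^{VC} = Tr_{UB} ρ^{UVBC}`. -/
def marginalVC {U V B C : Type*} [Fintype U] [Fintype B]
    (ω : Matrix ((U × V) × (B × C)) ((U × V) × (B × C)) ℂ) : Matrix (V × C) (V × C) ℂ :=
  Matrix.of fun i j => ∑ u, ∑ b, ω ((u, i.1), (b, i.2)) ((u, j.1), (b, j.2))

/-- The probability `p_U(u)` of the classical value `u` in the classical-quantum state
`σ = ∑_u p_U(u) |u⟩⟨u| ⊗ ρ_u`. -/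
def cqProb {U B : Type*} [Fintype B] (σ : Matrix (U × B) (U × B) ℂ) (u : U) : ℝ :=
  (∑ b, σ (u, b) (u, b)).re

/-- The conditional state `ρ_u` in the classical-quantum state `σ = ∑_u p_U(u) |u⟩⟨u| ⊗ ρ_u`
(the zero matrix if `p_U(u) = 0`, where it never matters). -/
def cqCond {U B : Type*} [Fintype B] (σ : Matrix (U × B) (U × B) ℂ) (u : U) : Matrix B B ℂ :=
  (cqProb σ u)⁻¹ • Matrix.of fun b b' => σ (u, b) (u, b')

/-- The marginal `ρ^B = Tr_U σ`. -/
def quantumMarginal {U B : Type*} [Fintype U] (σ : Matrix (U × B) (U × B) ℂ) : Matrix B B ℂ :=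
  Matrix.of fun b b' => ∑ u, σ (u, b) (u, b')

/-- `∑_u p_U(u) Tr[{ρ_u ⪰ t ρ^B} ρ_u]` for the classical-quantum state
`σ = ∑_u p_U(u) |u⟩⟨u| ⊗ ρ_u`. -/
def spectralMass {U B : Type*} [Fintype U] [Fintype B] [DecidableEq B]
    (σ : Matrix (U × B) (U × B) ℂ) (t : ℝ) : ℝ :=
  ∑ u, cqProb σ u *
    (nonnegProj (cqCond σ u - t • quantumMarginal σ) * cqCond σ u).trace.re

/-- The spectral inf mutual information rate of a sequence of classical-quantum states:
the supremum of all `γ` with `∑_u p(u) Tr[{ρ_u ⪰ 2^(nγ) ρ^B} ρ_u] → 1` as `n → ∞`. -/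
def spectralInfRate {U B : Type*} [Fintype U] [Fintype B] [DecidableEq B]
    (σ : ∀ n : ℕ, Matrix ((Fin n → U) × (Fin n → B)) ((Fin n → U) × (Fin n → B)) ℂ) : EReal :=
  sSup ((fun γ : ℝ => (γ : EReal)) ''
    {γ : ℝ | Tendsto (fun n : ℕ => spectralMass (σ n) ((2 : ℝ) ^ ((n : ℝ) * γ))) atTop (𝓝 1)})

/-- The mutual information density `log (p_{UV}(u,v) / (p_U(u) p_V(v)))`. -/
def infoDensity {U V : Type*} [Fintype U] [Fintype V] (p : U × V → ℝ) (w : U × V) : ℝ :=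
  Real.logb 2 (p w / ((∑ v, p (w.1, v)) * ∑ u, p (u, w.2)))

open Classical in
/-- The spectral sup mutual information rate of a sequence of joint probability mass functions: the
infimum of all `lam` such that the probability, under `p n`, that the mutual information density
divided by `n` exceeds `lam` tends to `0` as `n → ∞`. -/
def spectralSupRate {U V : Type*} [Fintype U] [Fintype V]
    (p : ∀ n : ℕ, (Fin n → U) × (Fin n → V) → ℝ) : EReal :=
  sInf ((fun lam : ℝ => (lam : EReal)) ''
    {lam : ℝ | Tendsto
      (fun n : ℕ => ∑ w, if lam < (1 / (n : ℝ)) * infoDensity (p n) w then p n w else 0)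
      atTop (𝓝 0)})

/-- A code for a classical-quantum broadcast channel with inputs in `X` and output spaces `B`, `C`:
an encoder and two decoding POVMs, for `M₁` and `M₂` messages, i.e. of rates `log M₁`, `log M₂`. -/
structure Code (X B C : Type*) [Fintype B] [Fintype C] [DecidableEq B] [DecidableEq C]
    (M₁ M₂ : ℕ) where
  enc : Fin M₁ × Fin M₂ → X
  decB : Fin M₁ → Matrix B B ℂ
  decC : Fin M₂ → Matrix C C ℂ
  povmB : IsPOVM decB
  povmC : IsPOVM decC

/-- The average probability of error of a code. -/
def Code.avgError {X B C : Type*} [Fintype B] [Fintype C] [DecidableEq B] [DecidableEq C]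
    {M₁ M₂ : ℕ} (K : Code X B C M₁ M₂) (ρ : X → Matrix (B × C) (B × C) ℂ) : ℝ :=
  1 / ((M₁ : ℝ) * (M₂ : ℝ)) *
    ∑ m : Fin M₁ × Fin M₂, ((1 - K.decB m.1 ⊗ₖ K.decC m.2) * ρ (K.enc m)).trace.re

/-- `(R₁, R₂)` is asymptotically achievable for the sequence `ρ` of channels: there are codes with
`M₁ n` and `M₂ n` messages such that `R_i ≤ liminf (log (M_i n)) / n` and the average probability of
error tends to `0`. -/
def AsymptoticallyAchievable {X B C : Type*} [Fintype B] [Fintype C] [DecidableEq B]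
    [DecidableEq C]
    (ρ : ∀ n : ℕ, (Fin n → X) →
      Matrix ((Fin n → B) × (Fin n → C)) ((Fin n → B) × (Fin n → C)) ℂ)
    (R₁ R₂ : ℝ) : Prop :=
  ∃ (M₁ M₂ : ℕ → ℕ) (K : ∀ n, Code (Fin n → X) (Fin n → B) (Fin n → C) (M₁ n) (M₂ n)),
    (∀ n, 0 < M₁ n) ∧ (∀ n, 0 < M₂ n) ∧
    (R₁ : EReal) ≤ liminf (fun n => ((Real.logb 2 (M₁ n) / (n : ℝ) : ℝ) : EReal)) atTop ∧
    (R₂ : EReal) ≤ liminf (fun n => ((Real.logb 2 (M₂ n) / (n : ℝ) : ℝ) : EReal)) atTop ∧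
    Tendsto (fun n => (K n).avgError (ρ n)) atTop (𝓝 0)

end CQBroadcast

end

/-!
Random coding after Marton. Choose thresholds `γ₁`, `γ₂`, `lam` admissible in the definitions of the
three spectral rates with `R₁ < γ₁`, `R₂ < γ₂` and `R₁ + R₂ < γ₁ + γ₂ - lam`, and bin rates
`r₁, r₂ > 0` with `Rᵢ + rᵢ < γᵢ` and `r₁ + r₂ > lam`. Every message of user `i` gets a bin of about
`2 ^ (n rᵢ)` codewords, drawn independently from `p_U` respectively `p_V`; a message pair is sent by the pair of
codewords from its two bins with the least decoding error.

Let `w(u,v)` be the likelihood ratio `p(u,v) / (p_U(u) p_V(v))`, cut off where it exceeds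
`2 ^ (n lam)`. Since `r₁ + r₂ > lam`, a second moment computation
(`IsLikelihoodRatio.variance_le`) shows that the mean of `w` over the pairs from two bins is close
to `1`. Hence the least error is at most about twice the `w`-weighted mean error
(`exists_cost_le`). Weighting independent codewords by `w` gives at most the joint law `p`, so the
mean over the codeword `v` of the output state on `B` is dominated by the conditional state of `B`
given `u`, and similarly for `C`. The error therefore splits into those of two single-user random
codes (`exists_code_of_decoders`); in particular the dependence of the chosen pair on the whole
codebook never has to be analysed.

For a single user the decoder is the square root measurement for the projectors `{ρ_u ⪰ t ρ}`, and
its error is bounded through the Hayashi–Nagaoka inequality (`hayashi_nagaoka`, `exists_decoder`) by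
the missing spectral mass plus the ratio of the number of codewords to `t = 2 ^ (n γᵢ)`. If `Rᵢ ≤ 0`
there is one message only and the decoder does not err, however large the bin; this is what allows
a negative rate to be traded for a larger bin.
-/

/-! ### Trace inequalities for the Loewner order -/

namespace CQBroadcast

section Loewner

open scoped MatrixOrder

variable {d : Type*} [Fintype d]

theorem conj_nonneg {A X : Matrix d d ℂ} (hA : 0 ≤ A) (hX : X.IsHermitian) : 0 ≤ X * A * X := by
  have h := (Matrix.nonneg_iff_posSemidef.1 hA).mul_mul_conjTranspose_same X
  rw [hX.eq] at h
  exact Matrix.nonneg_iff_posSemidef.2 h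

variable [DecidableEq d]

theorem re_trace_mul_nonneg {A B : Matrix d d ℂ} (hA : 0 ≤ A) (hB : 0 ≤ B) :
    0 ≤ (A * B).trace.re := by
  have hR := (Matrix.nonneg_iff_posSemidef.1 (CFC.sqrt_nonneg A)).isHermitian
  have h : (A * B).trace = (CFC.sqrt A * B * (CFC.sqrt A).conjTranspose).trace := by
    rw [hR.eq, mul_assoc, Matrix.trace_mul_comm (CFC.sqrt A), mul_assoc,
      CFC.sqrt_mul_sqrt_self A hA, Matrix.trace_mul_comm]
  have h2 := ((Matrix.nonneg_iff_posSemidef.1 hB).mul_mul_conjTranspose_same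
    (CFC.sqrt A)).trace_nonneg
  rw [h]
  exact (Complex.le_def.1 h2).1

theorem re_trace_mul_le_of_le_left {A A' B : Matrix d d ℂ} (hA : A ≤ A') (hB : 0 ≤ B) :
    (A * B).trace.re ≤ (A' * B).trace.re := by
  have h := re_trace_mul_nonneg (sub_nonneg.2 hA) hB
  rw [sub_mul, Matrix.trace_sub, Complex.sub_re] at h
  linarith

theorem le_sqrt_self {S : Matrix d d ℂ} (h0 : 0 ≤ S) (h1 : S ≤ 1) : S ≤ CFC.sqrt S := by
  open scoped Matrix.Norms.L2Operator in
  have hQ1 : CFC.sqrt S ≤ 1 := by simpa using CFC.sqrt_le_sqrt S 1 h1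
  have hQ0 := CFC.sqrt_nonneg S
  have hQS := CFC.sqrt_mul_sqrt_self S h0
  set Q := CFC.sqrt S
  have hQ : Q.IsHermitian := (Matrix.nonneg_iff_posSemidef.1 hQ0).isHermitian
  have e : Q - S = Q * (1 - Q) * Q + (1 - Q) * Q * (1 - Q) := by
    rw [← hQS]; noncomm_ring
  refine sub_nonneg.1 ?_
  rw [e]
  exact add_nonneg (conj_nonneg (sub_nonneg.2 hQ1) hQ)
    (conj_nonneg hQ0 (Matrix.isHermitian_one.sub hQ))

/-- The Hayashi–Nagaoka inequality
`1 - A^{-1/2} S A^{-1/2} ≤ 2 (1 - S) + 4 (A - S)` for `0 ≤ S ≤ 1` and an invertible `A ≥ S`. With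
`R = A^{1/2}` and `X = R⁻¹`, the right side minus the left side is
`(X - 2) (A - S) (X - 2) + 2 (X - 1) S (X - 1) + 4 (R - S)`, and `R ≥ S^{1/2} ≥ S` because the
square root is operator monotone. -/
theorem hayashi_nagaoka {S A : Matrix d d ℂ} (h0 : 0 ≤ S) (h1 : S ≤ 1) (hSA : S ≤ A)
    (hA : IsUnit A) :
    1 - (CFC.sqrt A)⁻¹ * S * (CFC.sqrt A)⁻¹ ≤ (2 : ℝ) • (1 - S) + (4 : ℝ) • (A - S) := by
  open scoped Matrix.Norms.L2Operator in
  have hSR : S ≤ CFC.sqrt A := (le_sqrt_self h0 h1).trans (CFC.sqrt_le_sqrt S A hSA)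
  have hR0 := CFC.sqrt_nonneg A
  have hRA := CFC.sqrt_mul_sqrt_self A (h0.trans hSA)
  set R := CFC.sqrt A
  have hR : R.IsHermitian := (Matrix.nonneg_iff_posSemidef.1 hR0).isHermitian
  have hRdet : IsUnit R.det := by
    rw [Matrix.isUnit_iff_isUnit_det, ← hRA, Matrix.det_mul] at hA
    exact isUnit_of_mul_isUnit_left hA
  have hXR : R⁻¹ * R = 1 := Matrix.nonsing_inv_mul R hRdet
  have hRX : R * R⁻¹ = 1 := Matrix.mul_nonsing_inv R hRdet
  have hX : (R⁻¹).IsHermitian := hR.inv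
  set X := R⁻¹
  have hXAX : X * A * X = 1 := by
    rw [← hRA, ← mul_assoc, hXR, one_mul, hRX]
  have hXA : X * A = R := by rw [← hRA, ← mul_assoc, hXR, one_mul]
  have hAX : A * X = R := by rw [← hRA, mul_assoc, hRX, mul_one]
  have h2 : (2 : Matrix d d ℂ).IsHermitian := by
    rw [← one_add_one_eq_two]; exact Matrix.isHermitian_one.add Matrix.isHermitian_one
  have e : (2 : ℝ) • (1 - S) + (4 : ℝ) • (A - S) - (1 - X * S * X)
      = (X - 2) * (A - S) * (X - 2) + ((X - 1) * S * (X - 1) + (X - 1) * S * (X - 1))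
        + (4 : ℝ) • (R - S) := by
    have e1 : (X - 2) * (A - S) * (X - 2)
        = X * A * X - 2 • (X * A) - 2 • (A * X) + 4 • A - X * S * X + 2 • (X * S) + 2 • (S * X)
          - 4 • S := by noncomm_ring
    have e2 : (X - 1) * S * (X - 1) = X * S * X - X * S - S * X + S := by noncomm_ring
    rw [e1, e2, hXAX, hXA, hAX]
    module
  refine sub_nonneg.1 ?_
  rw [e]
  have t2 := conj_nonneg h0 (hX.sub Matrix.isHermitian_one)
  exact add_nonneg (add_nonneg (conj_nonneg (sub_nonneg.2 hSA) (hX.sub h2)) (add_nonneg t2 t2))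
    (smul_nonneg (by norm_num) (sub_nonneg.2 hSR))

/-- The square root measurement: tests `S i` with `0 ≤ S i ≤ 1` give a POVM which, regularized by
`δ > 0`, detects `i` up to the defect of `S i` and the interference of the other tests. The outcomes
may be grouped by a map `g`, only the group being announced. -/
theorem exists_squareRoot_povm {ι M : Type*} [Fintype ι] [DecidableEq ι] [Fintype M]
    [DecidableEq M] [Nonempty M] (g : ι → M) (S : ι → Matrix d d ℂ)
    (h0 : ∀ i, 0 ≤ S i) (h1 : ∀ i, S i ≤ 1) {δ : ℝ} (hδ : 0 < δ) :
    ∃ T : M → Matrix d d ℂ, IsPOVM T ∧ ∀ i,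
      1 - T (g i) ≤ (2 : ℝ) • (1 - S i) + (4 : ℝ) • (∑ j ∈ Finset.univ.erase i, S j + δ • 1) := by
  set A : Matrix d d ℂ := ∑ j, S j + δ • 1 with hAdef
  have hsum : 0 ≤ ∑ j, S j := Finset.sum_nonneg fun j _ => h0 j
  have hδ1 : (0 : Matrix d d ℂ) ≤ δ • 1 := smul_nonneg hδ.le zero_le_one
  have hA : IsUnit A := by
    have : A.PosDef := by
      rw [hAdef, add_comm]
      have h1 : (δ • (1 : Matrix d d ℂ)).PosDef := Matrix.PosDef.one.smul hδ
      exact h1.add_posSemidef (Matrix.nonneg_iff_posSemidef.1 hsum)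
    exact this.isUnit
  set X := (CFC.sqrt A)⁻¹ with hXdef
  have hA0 : 0 ≤ A := add_nonneg hsum hδ1
  have hRA := CFC.sqrt_mul_sqrt_self A hA0
  have hR : (CFC.sqrt A).IsHermitian :=
    (Matrix.nonneg_iff_posSemidef.1 (CFC.sqrt_nonneg A)).isHermitian
  have hX : X.IsHermitian := hR.inv
  have hXAX : X * A * X = 1 := by
    have hRdet : IsUnit (CFC.sqrt A).det := by
      rw [Matrix.isUnit_iff_isUnit_det, ← hRA, Matrix.det_mul] at hA
      exact isUnit_of_mul_isUnit_left hA
    have hXR : X * CFC.sqrt A = 1 := Matrix.nonsing_inv_mul _ hRdet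
    have hRX : CFC.sqrt A * X = 1 := Matrix.mul_nonsing_inv _ hRdet
    nth_rw 1 [← hRA]
    rw [← mul_assoc, hXR, one_mul, hRX]
  -- the regularization leaves the effect `D` over, which is added to an arbitrary outcome `m₀`
  let m₀ : M := Classical.arbitrary M
  let D : Matrix d d ℂ := X * (δ • 1) * X
  have hD : 0 ≤ D := conj_nonneg hδ1 hX
  let G : M → Matrix d d ℂ := fun m => ∑ i with g i = m, X * S i * X
  have hG : ∀ m, 0 ≤ G m := fun m => Finset.sum_nonneg fun i _ => conj_nonneg (h0 i) hX
  refine ⟨fun m => G m + if m = m₀ then D else 0, ⟨fun m => ?_, ?_⟩, fun i => ?_⟩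
  · refine Matrix.nonneg_iff_posSemidef.1 (add_nonneg (hG m) ?_)
    split_ifs
    exacts [hD, le_rfl]
  · have hfib : ∑ m, G m = ∑ i, X * S i * X :=
      Finset.sum_fiberwise _ g fun i => X * S i * X
    rw [Finset.sum_add_distrib, hfib, Finset.sum_ite_eq' _ m₀, if_pos (Finset.mem_univ _),
      ← Finset.sum_mul, ← Finset.mul_sum, ← add_mul, ← mul_add, ← hAdef, hXAX]
  · have hle : X * S i * X ≤ G (g i) + if g i = m₀ then D else 0 := by
      have a1 : X * S i * X ≤ G (g i) :=
        Finset.single_le_sum (f := fun i => X * S i * X)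
          (fun j _ => conj_nonneg (h0 j) hX) (by simp)
      refine a1.trans (le_add_of_nonneg_right ?_)
      split_ifs
      exacts [hD, le_rfl]
    have hAS : A - S i = ∑ j ∈ Finset.univ.erase i, S j + δ • 1 := by
      rw [hAdef, ← Finset.add_sum_erase _ _ (Finset.mem_univ i)]
      abel
    have hSA : S i ≤ A := by
      rw [← sub_nonneg, hAS]
      exact add_nonneg (Finset.sum_nonneg fun j _ => h0 j) hδ1
    rw [← hAS]
    exact (sub_le_sub_left hle 1).trans (hayashi_nagaoka (h0 i) (h1 i) hSA hA)

/-- The trivial POVM for a single message. -/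
theorem isPOVM_one (M : Type*) [Fintype M] [Subsingleton M] [Nonempty M] :
    IsPOVM (fun _ : M => (1 : Matrix d d ℂ)) := by
  refine ⟨fun _ => Matrix.PosSemidef.one, ?_⟩
  have : Inhabited M := Classical.inhabited_of_nonempty ‹_›
  have : Unique M := Unique.mk' M
  simp

theorem IsPOVM.nonneg {M : Type*} [Fintype M] {T : M → Matrix d d ℂ} (hT : IsPOVM T) (m : M) :
    0 ≤ T m :=
  Matrix.nonneg_iff_posSemidef.2 (hT.1 m)

theorem IsPOVM.le_one {M : Type*} [Fintype M] {T : M → Matrix d d ℂ} (hT : IsPOVM T) (m : M) :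
    T m ≤ 1 := by
  rw [← hT.2]
  exact Finset.single_le_sum (f := T) (fun j _ => hT.nonneg j) (Finset.mem_univ m)

theorem nonnegProj_nonneg (A : Matrix d d ℂ) : 0 ≤ nonnegProj A :=
  cfc_nonneg fun x _ => by split_ifs <;> norm_num

theorem nonnegProj_le_one (A : Matrix d d ℂ) : nonnegProj A ≤ 1 :=
  cfc_le_one _ _ fun x _ => by split_ifs <;> norm_num

theorem re_trace_nonnegProj_mul_nonneg {A : Matrix d d ℂ} (hA : A.IsHermitian) :
    0 ≤ (nonnegProj A * A).trace.re := by
  have hc : ∀ h : ℝ → ℝ, ContinuousOn h (spectrum ℝ A) := fun h =>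
    (Matrix.finite_real_spectrum (A := A)).continuousOn h
  have hid : cfc (fun x : ℝ => x) A = A := cfc_id' ℝ A hA.isSelfAdjoint
  have h : nonnegProj A * A = cfc (fun x : ℝ => (if 0 ≤ x then (1 : ℝ) else 0) * x) A := by
    rw [cfc_mul _ _ A (hc _) (hc _), hid]; rfl
  have h0 : 0 ≤ nonnegProj A * A := by
    rw [h]
    refine cfc_nonneg fun x _ => ?_
    split_ifs with hx <;> simp [hx]
  simpa using re_trace_mul_nonneg h0 (zero_le_one (α := Matrix d d ℂ))

end Loewner

/-! ### Expectations over independent codewords -/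

section RandomCodebook

variable {U I : Type*} [Fintype U] [Fintype I] [DecidableEq I]

/-- The expectation of `F c` for a codebook `c` whose codewords `c i` are drawn independently from
the probability mass function `q`. -/
def iidMean (q : U → ℝ) (F : (I → U) → ℝ) : ℝ :=
  ∑ c, (∏ i, q (c i)) * F c

theorem iidMean_mono {q : U → ℝ} (hq : ∀ u, 0 ≤ q u) {F G : (I → U) → ℝ} (h : ∀ c, F c ≤ G c) :
    iidMean q F ≤ iidMean q G :=
  Finset.sum_le_sum fun c _ =>
    mul_le_mul_of_nonneg_left (h c) (Finset.prod_nonneg fun i _ => hq (c i))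

theorem iidMean_add (q : U → ℝ) (F G : (I → U) → ℝ) :
    iidMean q (fun c => F c + G c) = iidMean q F + iidMean q G := by
  simp only [iidMean, mul_add, Finset.sum_add_distrib]

theorem iidMean_const_mul (q : U → ℝ) (a : ℝ) (F : (I → U) → ℝ) :
    iidMean q (fun c => a * F c) = a * iidMean q F := by
  simp only [iidMean, Finset.mul_sum]
  exact Finset.sum_congr rfl fun c _ => by ring

theorem iidMean_sum {J : Type*} (q : U → ℝ) (s : Finset J) (F : J → (I → U) → ℝ) :
    iidMean q (fun c => ∑ j ∈ s, F j c) = ∑ j ∈ s, iidMean q (F j) := by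
  simp only [iidMean, Finset.mul_sum]
  exact Finset.sum_comm

theorem iidMean_const {q : U → ℝ} (hq : ∑ u, q u = 1) (a : ℝ) :
    iidMean q (fun _ : I → U => a) = a := by
  have h : ∑ c : I → U, ∏ i, q (c i) = ∏ _i : I, ∑ u, q u :=
    (Fintype.prod_sum fun (_ : I) u => q u).symm
  rw [iidMean, ← Finset.sum_mul, h, hq, Finset.prod_const_one, one_mul]

theorem iidMean_comm {V J : Type*} [Fintype V] [Fintype J] [DecidableEq J] (q : U → ℝ) (r : V → ℝ)
    (F : (I → U) → (J → V) → ℝ) :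
    iidMean q (fun c => iidMean r fun d => F c d) =
      iidMean r fun d => iidMean q fun c => F c d := by
  simp only [iidMean, Finset.mul_sum]
  rw [Finset.sum_comm]
  exact Finset.sum_congr rfl fun c _ => Finset.sum_congr rfl fun d _ => by ring

/-- Drawing one codeword afresh does not change the expectation: exchanging the codeword with the
fresh one is a weight-preserving involution. -/
theorem iidMean_resample {q : U → ℝ} (hq : ∑ u, q u = 1) (F : (I → U) → ℝ) (k : I) :
    iidMean q F = iidMean q fun c => ∑ u, q u * F (Function.update c k u) := by
  let e : (I → U) × U → (I → U) × U := fun x => (Function.update x.1 k x.2, x.1 k)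
  have he : Function.Involutive e := fun x => by simp [e]
  have hw : ∀ x : (I → U) × U,
      (∏ i, q ((e x).1 i)) * q (e x).2 = (∏ i, q (x.1 i)) * q x.2 := fun x => by
    have h : ∏ i ∈ Finset.univ.erase k, q (Function.update x.1 k x.2 i)
        = ∏ i ∈ Finset.univ.erase k, q (x.1 i) :=
      Finset.prod_congr rfl fun i hi => by
        rw [Function.update_of_ne (Finset.ne_of_mem_erase hi)]
    simp only [e]
    rw [← Finset.mul_prod_erase _ _ (Finset.mem_univ k), h,
      ← Finset.mul_prod_erase Finset.univ (fun i => q (x.1 i)) (Finset.mem_univ k),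
      Function.update_self]
    ring
  calc iidMean q F = ∑ x : (I → U) × U, (∏ i, q (x.1 i)) * q x.2 * F x.1 := by
        rw [Fintype.sum_prod_type, iidMean]
        refine Finset.sum_congr rfl fun c _ => ?_
        dsimp only
        rw [← Finset.sum_mul, ← Finset.mul_sum, hq, mul_one]
    _ = ∑ x : (I → U) × U, (∏ i, q ((e x).1 i)) * q (e x).2 * F (e x).1 :=
        (Equiv.sum_comp he.toPerm fun x : (I → U) × U => (∏ i, q (x.1 i)) * q x.2 * F x.1).symm
    _ = _ := by
        rw [Fintype.sum_prod_type, iidMean]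
        refine Finset.sum_congr rfl fun c _ => ?_
        rw [Finset.mul_sum]
        refine Finset.sum_congr rfl fun u _ => ?_
        rw [hw, mul_assoc]

theorem iidMean_eval {q : U → ℝ} (hq : ∑ u, q u = 1) (k : I) (g : U → ℝ) :
    iidMean q (fun c => g (c k)) = ∑ u, q u * g u := by
  rw [iidMean_resample hq _ k]
  simp only [Function.update_self]
  exact iidMean_const hq _

theorem iidMean_eval₂ {q : U → ℝ} (hq : ∑ u, q u = 1) {j k : I} (hjk : j ≠ k)
    (g : U → U → ℝ) :
    iidMean q (fun c => g (c j) (c k)) = ∑ u, q u * ∑ u', q u' * g u u' := by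
  rw [iidMean_resample hq _ k]
  simp only [Function.update_self, Function.update_of_ne hjk]
  exact iidMean_eval hq j fun u => ∑ u', q u' * g u u'

theorem exists_le_iidMean {q : U → ℝ} (hq0 : ∀ u, 0 ≤ q u) (hq : ∑ u, q u = 1)
    (F : (I → U) → ℝ) : ∃ c, F c ≤ iidMean q F := by
  by_contra! h
  have hw0 : ∀ c : I → U, 0 ≤ ∏ i, q (c i) := fun c => Finset.prod_nonneg fun i _ => hq0 (c i)
  have h1 : ∑ c : I → U, ∏ i, q (c i) = 1 := by
    simpa [iidMean] using iidMean_const (I := I) hq 1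
  have hle : iidMean q (fun _ : I → U => iidMean q F) ≤ iidMean q F :=
    iidMean_mono hq0 fun c => (h c).le
  obtain ⟨c, hc⟩ : ∃ c : I → U, 0 < ∏ i, q (c i) := by
    by_contra! h'
    have : ∑ c : I → U, ∏ i, q (c i) ≤ 0 := Finset.sum_nonpos fun c _ => h' c
    linarith
  have hlt : iidMean q (fun _ : I → U => iidMean q F) < iidMean q F :=
    Finset.sum_lt_sum (fun c _ => mul_le_mul_of_nonneg_left (h c).le (hw0 c))
      ⟨c, Finset.mem_univ c, mul_lt_mul_of_pos_left (h c) hc⟩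
  rw [iidMean_const hq] at hlt
  exact lt_irrefl _ hlt

end RandomCodebook

/-! ### Random coding for a single classical-quantum channel -/

section SingleUser

open scoped MatrixOrder

variable {U B M L : Type*} [Fintype U] [Fintype B] [DecidableEq B] [Fintype M] [DecidableEq M]
  [Fintype L] [DecidableEq L]

/-- Random coding for the classical-quantum channel `u ↦ τ u` with `M` messages, each represented by
a bin of `L` independent codewords. The decoder is the square root measurement for the projectors
`{τ u ⪰ t ρ}`, where `ρ` is the mean output state; it announces the bin. With a single message the
trivial decoder makes no error, however large the bin. -/
theorem exists_decoder [Nonempty M] {q : U → ℝ} (hq0 : ∀ u, 0 ≤ q u) (hq : ∑ u, q u = 1)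
    {τ : U → Matrix B B ℂ} (hτ0 : ∀ u, 0 ≤ τ u) (hτ1 : ∀ u, (τ u).trace.re ≤ 1)
    {ρ : Matrix B B ℂ} (hρ : ρ = ∑ u, q u • τ u) {t : ℝ} (ht : 0 < t) :
    ∃ T : (M × L → U) → M → Matrix B B ℂ, (∀ c, IsPOVM (T c)) ∧ ∀ k : M × L,
      iidMean q (fun c => ((1 - T c k.1) * τ (c k)).trace.re) ≤
        if Fintype.card M ≤ 1 then 0 else
          2 * (1 - ∑ u, q u * (nonnegProj (τ u - t • ρ) * τ u).trace.re)
            + 4 * ((Fintype.card M : ℝ) * Fintype.card L / t) := by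
  split_ifs with hM
  · have : Subsingleton M := Fintype.card_le_one_iff_subsingleton.1 hM
    refine ⟨fun _ _ => 1, fun _ => isPOVM_one M, fun k => ?_⟩
    simp [iidMean]
  set S : U → Matrix B B ℂ := fun u => nonnegProj (τ u - t • ρ) with hS
  have hS0 : ∀ u, 0 ≤ S u := fun u => nonnegProj_nonneg _
  have hS1 : ∀ u, S u ≤ 1 := fun u => nonnegProj_le_one _
  have hρ0 : 0 ≤ ρ := hρ ▸ Finset.sum_nonneg fun u _ => smul_nonneg (hq0 u) (hτ0 u)
  -- a false alarm of the test for `u` on the mean state is unlikely: `t Tr[S ρ] ≤ Tr[S τ] ≤ 1`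
  have htest : ∀ u, (S u * ρ).trace.re ≤ 1 / t := fun u => by
    have hH : (τ u - t • ρ).IsHermitian :=
      (Matrix.nonneg_iff_posSemidef.1 (hτ0 u)).isHermitian.sub
        (Matrix.nonneg_iff_posSemidef.1 (smul_nonneg ht.le hρ0)).isHermitian
    have h1 := re_trace_nonnegProj_mul_nonneg hH
    have h2 := re_trace_mul_le_of_le_left (hS1 u) (hτ0 u)
    rw [one_mul] at h2
    have h3 : (S u * (τ u - t • ρ)).trace.re = (S u * τ u).trace.re - t * (S u * ρ).trace.re := by
      rw [mul_sub, Matrix.trace_sub, Complex.sub_re, mul_smul_comm, Matrix.trace_smul,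
        Complex.smul_re, smul_eq_mul]
    rw [le_div_iff₀ ht]
    have := hτ1 u
    change 0 ≤ (S u * (τ u - t • ρ)).trace.re at h1
    linarith
  -- the regularization `δ = 1 / t` costs as much as one more competing codeword
  have hex := fun c : M × L → U =>
    exists_squareRoot_povm (Prod.fst : M × L → M) (fun i => S (c i)) (fun i => hS0 _)
      (fun i => hS1 _) (δ := 1 / t) (by positivity)
  choose T hT hTle using hex
  refine ⟨T, hT, fun k => ?_⟩
  have hpt : ∀ c : M × L → U, ((1 - T c k.1) * τ (c k)).trace.re ≤
      2 * (1 - (S (c k) * τ (c k)).trace.re)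
        + 4 * (∑ j ∈ Finset.univ.erase k, (S (c j) * τ (c k)).trace.re + 1 / t) := fun c => by
    refine (re_trace_mul_le_of_le_left (hTle c k) (hτ0 (c k))).trans ?_
    have e : (((2 : ℝ) • (1 - S (c k))
          + (4 : ℝ) • (∑ j ∈ Finset.univ.erase k, S (c j) + (1 / t) • 1)) * τ (c k)).trace.re
        = 2 * ((τ (c k)).trace.re - (S (c k) * τ (c k)).trace.re)
          + 4 * (∑ j ∈ Finset.univ.erase k, (S (c j) * τ (c k)).trace.re
            + 1 / t * (τ (c k)).trace.re) := by
      simp only [add_mul, sub_mul, smul_mul_assoc, one_mul, Finset.sum_mul, Matrix.trace_add,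
        Matrix.trace_sub, Matrix.trace_smul, Matrix.trace_sum, Complex.add_re, Complex.sub_re,
        Complex.smul_re, Complex.re_sum, smul_eq_mul]
    rw [e]
    have h1 := hτ1 (c k)
    have h2 : 1 / t * (τ (c k)).trace.re ≤ 1 / t :=
      mul_le_of_le_one_right (by positivity) h1
    linarith
  have hcross : ∀ j ∈ Finset.univ.erase k,
      iidMean q (fun c : M × L → U => (S (c j) * τ (c k)).trace.re) ≤ 1 / t := fun j hj => by
    rw [iidMean_eval₂ hq (Finset.ne_of_mem_erase hj) fun u u' => (S u * τ u').trace.re]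
    have h : ∀ u, ∑ u', q u' * (S u * τ u').trace.re = (S u * ρ).trace.re := fun u => by
      simp only [hρ, Finset.mul_sum, Matrix.trace_sum, Complex.re_sum, mul_smul_comm,
        Matrix.trace_smul, Complex.smul_re, smul_eq_mul]
    calc ∑ u, q u * ∑ u', q u' * (S u * τ u').trace.re ≤ ∑ u, q u * (1 / t) :=
          Finset.sum_le_sum fun u _ => mul_le_mul_of_nonneg_left (h u ▸ htest u) (hq0 u)
      _ = 1 / t := by rw [← Finset.sum_mul, hq, one_mul]
  have hcard : ((Finset.univ.erase k).card : ℝ) + 1 = Fintype.card M * Fintype.card L := by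
    rw [← Nat.cast_add_one, Finset.card_erase_add_one (Finset.mem_univ k), Finset.card_univ,
      Fintype.card_prod, Nat.cast_mul]
  refine (iidMean_mono hq0 hpt).trans ?_
  rw [iidMean_add, iidMean_const_mul, iidMean_const_mul, iidMean_add, iidMean_sum,
    iidMean_const hq, iidMean_eval hq k fun u => 1 - (S u * τ u).trace.re]
  have h1 : ∑ u, q u * (1 - (S u * τ u).trace.re) = 1 - ∑ u, q u * (S u * τ u).trace.re := by
    simp only [mul_sub, mul_one, Finset.sum_sub_distrib, hq]
  have h2 := Finset.sum_le_sum hcross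
  rw [Finset.sum_const, nsmul_eq_mul] at h2
  rw [h1, ← hcard, add_div]
  have h3 : ((Finset.univ.erase k).card : ℝ) * (1 / t) = (Finset.univ.erase k).card / t := by ring
  linarith

end SingleUser

/-! ### Mutual covering -/

section Covering

variable {U V I J L₁ L₂ : Type*} [Fintype U] [Fintype V] [Fintype I] [DecidableEq I] [Fintype J]
  [DecidableEq J] [Fintype L₁] [DecidableEq L₁] [Fintype L₂] [DecidableEq L₂]

/-- A likelihood ratio `w` between a subprobability on `U × V` and the product of the probability
mass functions `q` and `r`: both partial means are at most one, and `w` is bounded by `K`. -/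
structure IsLikelihoodRatio (q : U → ℝ) (r : V → ℝ) (w : U → V → ℝ) (K : ℝ) : Prop where
  q_nonneg : ∀ u, 0 ≤ q u
  q_sum : ∑ u, q u = 1
  r_nonneg : ∀ v, 0 ≤ r v
  r_sum : ∑ v, r v = 1
  nonneg : ∀ u v, 0 ≤ w u v
  bound_nonneg : 0 ≤ K
  le_bound : ∀ u v, w u v ≤ K
  mean_right_le : ∀ u, ∑ v, r v * w u v ≤ 1
  mean_left_le : ∀ v, ∑ u, q u * w u v ≤ 1

theorem sum_mul_sq_le_one {q : U → ℝ} (hq0 : ∀ u, 0 ≤ q u) (hq : ∑ u, q u = 1) {g : U → ℝ}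
    (hg0 : ∀ u, 0 ≤ g u) (hg1 : ∀ u, g u ≤ 1) : ∑ u, q u * (g u * g u) ≤ 1 := by
  rw [← hq]
  exact Finset.sum_le_sum fun u _ =>
    mul_le_of_le_one_right (hq0 u) (mul_le_one₀ (hg1 u) (hg0 u) (hg1 u))

variable {q : U → ℝ} {r : V → ℝ} {w : U → V → ℝ} {K : ℝ}

/-- Correlation of the likelihood ratios of two pairs of codewords. Pairs without a common codeword
are independent; a single common codeword costs at most `1`, because the partial means of `w` are at
most `1`; a common pair costs at most `K`. -/
theorem IsLikelihoodRatio.correlation_le (hw : IsLikelihoodRatio q r w K) (i i' : I) (j j' : J) :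
    iidMean q (fun c => iidMean r fun d => w (c i) (d j) * w (c i') (d j')) ≤
      (∑ u, q u * ∑ v, r v * w u v) ^ 2 + (if i = i' then 1 else 0) + (if j = j' then 1 else 0)
        + (if i = i' then (if j = j' then K else 0) else 0) := by
  set g : U → ℝ := fun u => ∑ v, r v * w u v with hg
  have hg0 : ∀ u, 0 ≤ g u := fun u =>
    Finset.sum_nonneg fun v _ => mul_nonneg (hw.r_nonneg v) (hw.nonneg u v)
  have hg1 : ∀ u, g u ≤ 1 := hw.mean_right_le
  have hsq := sq_nonneg (∑ u, q u * g u)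
  by_cases hj : j = j'
  · subst hj
    have e1 : ∀ c : I → U, iidMean r (fun d : J → V => w (c i) (d j) * w (c i') (d j))
        = ∑ v, r v * (w (c i) v * w (c i') v) := fun c =>
      iidMean_eval hw.r_sum j fun v => w (c i) v * w (c i') v
    simp only [e1, if_true]
    by_cases hi : i = i'
    · subst hi
      rw [iidMean_eval hw.q_sum i fun u => ∑ v, r v * (w u v * w u v)]
      have hmain : ∑ u, q u * ∑ v, r v * (w u v * w u v) ≤ K := by
        calc ∑ u, q u * ∑ v, r v * (w u v * w u v) ≤ ∑ u, q u * (K * g u) := by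
              refine Finset.sum_le_sum fun u _ => mul_le_mul_of_nonneg_left ?_ (hw.q_nonneg u)
              rw [hg, Finset.mul_sum]
              refine Finset.sum_le_sum fun v _ => ?_
              have := mul_le_mul_of_nonneg_right (hw.le_bound u v)
                (mul_nonneg (hw.r_nonneg v) (hw.nonneg u v))
              linarith
          _ ≤ ∑ u, q u * K := Finset.sum_le_sum fun u _ =>
              mul_le_mul_of_nonneg_left
                (mul_le_of_le_one_right hw.bound_nonneg (hg1 u)) (hw.q_nonneg u)
          _ = K := by rw [← Finset.sum_mul, hw.q_sum, one_mul]
      simp only [if_true]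
      linarith
    · rw [iidMean_eval₂ hw.q_sum hi fun u u' => ∑ v, r v * (w u v * w u' v)]
      have e2 : ∑ u, q u * ∑ u', q u' * ∑ v, r v * (w u v * w u' v)
          = ∑ v, r v * ((∑ u, q u * w u v) * ∑ u', q u' * w u' v) := by
        simp_rw [Finset.sum_mul_sum, Finset.mul_sum]
        rw [Finset.sum_comm (s := Finset.univ (α := V))]
        refine Finset.sum_congr rfl fun u _ => ?_
        rw [Finset.sum_comm (s := Finset.univ (α := V))]
        exact Finset.sum_congr rfl fun u' _ => Finset.sum_congr rfl fun v _ => by ring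
      rw [e2]
      have := sum_mul_sq_le_one hw.r_nonneg hw.r_sum
        (fun v => Finset.sum_nonneg fun u _ => mul_nonneg (hw.q_nonneg u) (hw.nonneg u v))
        hw.mean_left_le
      simp only [if_neg hi]
      linarith
  · have e1 : ∀ c : I → U, iidMean r (fun d : J → V => w (c i) (d j) * w (c i') (d j'))
        = g (c i) * g (c i') := fun c => by
      rw [iidMean_eval₂ hw.r_sum hj fun v v' => w (c i) v * w (c i') v']
      simp only [hg]
      rw [Finset.sum_mul_sum]
      refine Finset.sum_congr rfl fun v _ => ?_
      rw [Finset.mul_sum]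
      exact Finset.sum_congr rfl fun v' _ => by ring
    simp only [e1, if_neg hj, ite_self, add_zero]
    by_cases hi : i = i'
    · subst hi
      rw [iidMean_eval hw.q_sum i fun u => g u * g u, if_pos rfl]
      linarith [sum_mul_sq_le_one hw.q_nonneg hw.q_sum hg0 hg1]
    · rw [iidMean_eval₂ hw.q_sum hi fun u u' => g u * g u', if_neg hi, add_zero, sq,
        Finset.sum_mul_sum]
      refine le_of_eq (Finset.sum_congr rfl fun u _ => ?_)
      rw [Finset.mul_sum]
      exact Finset.sum_congr rfl fun u' _ => by ring

/-- Mutual covering: the mean `W` of the likelihood ratio over all pairs of codewords from two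
bins concentrates around its expectation `P`. -/
theorem IsLikelihoodRatio.variance_le [Nonempty L₁] [Nonempty L₂]
    (hw : IsLikelihoodRatio q r w K) {a : L₁ → I} (ha : Function.Injective a) {b : L₂ → J}
    (hb : Function.Injective b) :
    iidMean q (fun c => iidMean r fun d =>
      ((∑ l₁, ∑ l₂, w (c (a l₁)) (d (b l₂))) / ((Fintype.card L₁ : ℝ) * Fintype.card L₂)
        - ∑ u, q u * ∑ v, r v * w u v) ^ 2)
      ≤ 1 / Fintype.card L₁ + 1 / Fintype.card L₂
        + K / ((Fintype.card L₁ : ℝ) * Fintype.card L₂) := by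
  set P := ∑ u, q u * ∑ v, r v * w u v with hP
  set N₁ : ℝ := (Fintype.card L₁ : ℝ) with hN₁
  set N₂ : ℝ := (Fintype.card L₂ : ℝ) with hN₂
  have h1 : 0 < N₁ := by rw [hN₁]; exact_mod_cast Fintype.card_pos
  have h2 : 0 < N₂ := by rw [hN₂]; exact_mod_cast Fintype.card_pos
  have hmean : ∀ l₁ l₂, iidMean q (fun c : I → U => iidMean r fun d : J → V =>
      w (c (a l₁)) (d (b l₂))) = P := fun l₁ l₂ => by
    simp only [fun c : I → U => iidMean_eval hw.r_sum (b l₂) fun v => w (c (a l₁)) v]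
    exact iidMean_eval hw.q_sum (a l₁) fun u => ∑ v, r v * w u v
  have hexp : ∀ (c : I → U) (d : J → V),
      ((∑ l₁, ∑ l₂, w (c (a l₁)) (d (b l₂))) / (N₁ * N₂) - P) ^ 2
        = (1 / (N₁ * N₂)) ^ 2 * (∑ l₁, ∑ l₂, ∑ l₁', ∑ l₂',
            w (c (a l₁)) (d (b l₂)) * w (c (a l₁')) (d (b l₂')))
          + (-(2 * P / (N₁ * N₂)) * (∑ l₁, ∑ l₂, w (c (a l₁)) (d (b l₂))) + P ^ 2) := by
    intro c d
    have : ∑ l₁, ∑ l₂, ∑ l₁', ∑ l₂', w (c (a l₁)) (d (b l₂)) * w (c (a l₁')) (d (b l₂'))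
        = (∑ l₁, ∑ l₂, w (c (a l₁)) (d (b l₂))) ^ 2 := by
      rw [sq]
      simp only [← Finset.mul_sum, ← Finset.sum_mul]
    rw [this]
    ring
  simp only [hexp, iidMean_add, iidMean_const_mul, iidMean_sum, hmean, iidMean_const hw.r_sum,
    iidMean_const hw.q_sum]
  have hcor : ∑ l₁, ∑ l₂, ∑ l₁', ∑ l₂', iidMean q (fun c : I → U => iidMean r fun d : J → V =>
        w (c (a l₁)) (d (b l₂)) * w (c (a l₁')) (d (b l₂')))
      ≤ ∑ l₁ : L₁, ∑ l₂ : L₂, ∑ l₁' : L₁, ∑ l₂' : L₂, (P ^ 2 + (if l₁ = l₁' then 1 else 0)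
        + (if l₂ = l₂' then 1 else 0) + (if l₁ = l₁' then (if l₂ = l₂' then K else 0) else 0)) :=
    Finset.sum_le_sum fun l₁ _ => Finset.sum_le_sum fun l₂ _ => Finset.sum_le_sum fun l₁' _ =>
      Finset.sum_le_sum fun l₂' _ => by
        simpa only [ha.eq_iff, hb.eq_iff] using
          hw.correlation_le (a l₁) (a l₁') (b l₂) (b l₂')
  have hev : ∑ l₁ : L₁, ∑ l₂ : L₂, ∑ l₁' : L₁, ∑ l₂' : L₂, (P ^ 2 + (if l₁ = l₁' then 1 else 0)
        + (if l₂ = l₂' then 1 else 0) + (if l₁ = l₁' then (if l₂ = l₂' then K else 0) else 0))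
      = (N₁ * N₂) ^ 2 * P ^ 2 + N₁ * N₂ * N₂ + N₁ * N₂ * N₁ + N₁ * N₂ * K := by
    simp only [Finset.sum_add_distrib, Finset.sum_const, Finset.card_univ, nsmul_eq_mul,
      Finset.sum_ite_eq, Finset.mem_univ, if_true, ← hN₁, ← hN₂, Finset.sum_ite_irrel,
      mul_zero, mul_ite, mul_one]
    ring
  rw [hev] at hcor
  simp only [Finset.sum_const, Finset.card_univ, nsmul_eq_mul, ← hN₁, ← hN₂]
  have h3 := mul_le_mul_of_nonneg_left hcor (sq_nonneg (1 / (N₁ * N₂)))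
  have e1 : (1 / (N₁ * N₂)) ^ 2 *
        ((N₁ * N₂) ^ 2 * P ^ 2 + N₁ * N₂ * N₂ + N₁ * N₂ * N₁ + N₁ * N₂ * K)
      = P ^ 2 + (1 / N₁ + 1 / N₂ + K / (N₁ * N₂)) := by
    field_simp
    ring
  have e2 : -(2 * P / (N₁ * N₂)) * (N₁ * (N₂ * P)) = - (2 * P ^ 2) := by
    field_simp
  rw [e1] at h3
  rw [e2]
  linarith

end Covering

/-! ### One-shot Marton coding -/

section OneShot

open scoped MatrixOrder

variable {U V X B C : Type*} [Fintype U] [Fintype V]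

/-- The partial trace over the second tensor factor. -/
def traceSnd [Fintype C] (θ : Matrix (B × C) (B × C) ℂ) : Matrix B B ℂ :=
  Matrix.of fun b b' => ∑ c, θ (b, c) (b', c)

/-- The partial trace over the first tensor factor. -/
def traceFst [Fintype B] (θ : Matrix (B × C) (B × C) ℂ) : Matrix C C ℂ :=
  Matrix.of fun c c' => ∑ b, θ (b, c) (b, c')

theorem traceSnd_nonneg [Fintype C] {θ : Matrix (B × C) (B × C) ℂ} (h : θ.PosSemidef) :
    0 ≤ traceSnd θ := by
  have e : traceSnd θ = ∑ c, θ.submatrix (fun b => (b, c)) fun b => (b, c) := by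
    ext b b'
    simp [traceSnd, Matrix.sum_apply]
  rw [e]
  exact Finset.sum_nonneg fun c _ => Matrix.nonneg_iff_posSemidef.2 (h.submatrix _)

theorem traceFst_nonneg [Fintype B] {θ : Matrix (B × C) (B × C) ℂ} (h : θ.PosSemidef) :
    0 ≤ traceFst θ := by
  have e : traceFst θ = ∑ b, θ.submatrix (fun c => (b, c)) fun c => (b, c) := by
    ext c c'
    simp [traceFst, Matrix.sum_apply]
  rw [e]
  exact Finset.sum_nonneg fun b _ => Matrix.nonneg_iff_posSemidef.2 (h.submatrix _)

variable [Fintype B] [Fintype C]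

theorem trace_traceSnd (θ : Matrix (B × C) (B × C) ℂ) : (traceSnd θ).trace = θ.trace := by
  simp [traceSnd, Matrix.trace, Fintype.sum_prod_type]

theorem trace_traceFst (θ : Matrix (B × C) (B × C) ℂ) : (traceFst θ).trace = θ.trace := by
  simp [traceFst, Matrix.trace, Fintype.sum_prod_type_right]

theorem trace_kronecker_one_mul [DecidableEq C] (A : Matrix B B ℂ) (θ : Matrix (B × C) (B × C) ℂ) :
    ((A ⊗ₖ (1 : Matrix C C ℂ)) * θ).trace = (A * traceSnd θ).trace := by
  simp only [Matrix.trace, Matrix.diag_apply, Matrix.mul_apply, Fintype.sum_prod_type,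
    Matrix.kronecker_apply, Matrix.one_apply, mul_ite, mul_one, mul_zero, ite_mul, zero_mul,
    Finset.sum_ite_eq, Finset.mem_univ, if_true, traceSnd, Matrix.of_apply, Finset.mul_sum]
  exact Finset.sum_congr rfl fun b _ => Finset.sum_comm

theorem trace_one_kronecker_mul [DecidableEq B] (A : Matrix C C ℂ) (θ : Matrix (B × C) (B × C) ℂ) :
    (((1 : Matrix B B ℂ) ⊗ₖ A) * θ).trace = (A * traceFst θ).trace := by
  simp only [Matrix.trace, Matrix.diag_apply, Matrix.mul_apply, Fintype.sum_prod_type_right,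
    Matrix.kronecker_apply, Matrix.one_apply, ite_mul, one_mul, zero_mul,
    Finset.sum_ite_eq, Finset.mem_univ, if_true, traceFst, Matrix.of_apply, Finset.mul_sum]
  exact Finset.sum_congr rfl fun b _ => Finset.sum_comm

theorem kronecker_nonneg {S : Matrix B B ℂ} {T : Matrix C C ℂ} (hS : 0 ≤ S) (hT : 0 ≤ T) :
    0 ≤ S ⊗ₖ T :=
  Matrix.nonneg_iff_posSemidef.2
    ((Matrix.nonneg_iff_posSemidef.1 hS).kronecker (Matrix.nonneg_iff_posSemidef.1 hT))

variable [DecidableEq B] [DecidableEq C]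

/-- The union bound for a pair of effects on different tensor factors. -/
theorem one_sub_kronecker_le {S : Matrix B B ℂ} {T : Matrix C C ℂ} (hS : S ≤ 1) (hT : T ≤ 1) :
    1 - S ⊗ₖ T ≤ (1 - S) ⊗ₖ (1 : Matrix C C ℂ) + (1 : Matrix B B ℂ) ⊗ₖ (1 - T) := by
  have h := kronecker_nonneg (sub_nonneg.2 hS) (sub_nonneg.2 hT)
  rw [← sub_nonneg]
  convert h using 1
  rw [← Matrix.one_kronecker_one]
  ext ⟨b, c⟩ ⟨b', c'⟩
  simp only [Matrix.sub_apply, Matrix.add_apply, Matrix.kronecker_apply]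
  ring

theorem kronecker_le_one {S : Matrix B B ℂ} {T : Matrix C C ℂ} (hS : S ≤ 1) (hT0 : 0 ≤ T)
    (hT : T ≤ 1) : S ⊗ₖ T ≤ 1 := by
  have h := add_nonneg (kronecker_nonneg (sub_nonneg.2 hS) hT0)
    (kronecker_nonneg (zero_le_one (α := Matrix B B ℂ)) (sub_nonneg.2 hT))
  rw [← sub_nonneg]
  convert h using 1
  rw [← Matrix.one_kronecker_one]
  ext ⟨b, c⟩ ⟨b', c'⟩
  simp only [Matrix.sub_apply, Matrix.add_apply, Matrix.kronecker_apply]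
  ring

/-- If the weights `w` have mean `W` close to `P ≈ 1`, then some index has a cost `e` of at most
about twice the `w`-weighted mean cost. The first two terms of the bound add up to at least `1`
unless `W ≥ 1/2`, and for `W ≥ 1/2` the least cost is at most the `w`-weighted average. -/
theorem exists_cost_le {ι : Type*} [Fintype ι] [Nonempty ι] {w e : ι → ℝ} (hw : ∀ i, 0 ≤ w i)
    (he0 : ∀ i, 0 ≤ e i) (he1 : ∀ i, e i ≤ 1) {P : ℝ} (hP : P ≤ 1) :
    ∃ i, e i ≤ 16 * ((∑ i, w i) / Fintype.card ι - P) ^ 2 + 4 * (1 - P)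
      + 2 / Fintype.card ι * ∑ i, w i * e i := by
  obtain ⟨i, hi⟩ := Finite.exists_min e
  refine ⟨i, ?_⟩
  have hN : (0 : ℝ) < Fintype.card ι := by exact_mod_cast Fintype.card_pos
  set W : ℝ := (∑ i, w i) / Fintype.card ι with hW
  have hs : 0 ≤ 2 / (Fintype.card ι : ℝ) * ∑ i, w i * e i :=
    mul_nonneg (by positivity) (Finset.sum_nonneg fun i _ => mul_nonneg (hw i) (he0 i))
  have hsq := sq_nonneg (W - P)
  rcases lt_or_ge W (1 / 2) with h | h
  · have : 1 ≤ 16 * (W - P) ^ 2 + 4 * (1 - P) := by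
      rcases le_or_gt P (3 / 4) with hp | hp
      · linarith
      · nlinarith
    linarith [he1 i]
  · have h1 : (∑ j, w j) * e i ≤ ∑ j, w j * e j := by
      rw [Finset.sum_mul]
      exact Finset.sum_le_sum fun j _ => mul_le_mul_of_nonneg_left (hi j) (hw j)
    have h2 : 2 * W * e i ≤ 2 / Fintype.card ι * ∑ i, w i * e i := by
      have := mul_le_mul_of_nonneg_left h1 (by positivity : 0 ≤ 2 / (Fintype.card ι : ℝ))
      refine le_trans (le_of_eq ?_) this
      rw [hW]; ring
    have h3 : e i ≤ 2 * W * e i := le_mul_of_one_le_left (he0 i) (by linarith)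
    linarith

/-- Marton coding with given single-user decoders. The codewords of the two users are drawn
independently, and a message pair is sent by the pair of codewords from the two bins with the least
error. The likelihood ratio `w` turns the expectation over independent codewords into the
expectation over the joint law, which is why the errors of the two decoders enter only
through the states `τ u` and `τ' v` that dominate the outputs conditioned on a single codeword. -/
theorem exists_code_of_decoders {q : U → ℝ} {r : V → ℝ} {w : U → V → ℝ} {K : ℝ}
    (hw : IsLikelihoodRatio q r w K) (f : U × V → X) {ρ : X → Matrix (B × C) (B × C) ℂ}
    (hρ : ∀ x, IsState (ρ x)) {M₁ M₂ L₁ L₂ : ℕ} [NeZero M₁] [NeZero M₂] [NeZero L₁] [NeZero L₂]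
    {τ : U → Matrix B B ℂ} (hτ : ∀ u, ∑ v, (r v * w u v) • traceSnd (ρ (f (u, v))) ≤ τ u)
    {τ' : V → Matrix C C ℂ} (hτ' : ∀ v, ∑ u, (q u * w u v) • traceFst (ρ (f (u, v))) ≤ τ' v)
    {T : (Fin M₁ × Fin L₁ → U) → Fin M₁ → Matrix B B ℂ} (hT : ∀ c, IsPOVM (T c))
    {T' : (Fin M₂ × Fin L₂ → V) → Fin M₂ → Matrix C C ℂ} (hT' : ∀ d, IsPOVM (T' d)) {ε ε' : ℝ}
    (hε : ∀ k, iidMean q (fun c => ((1 - T c k.1) * τ (c k)).trace.re) ≤ ε)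
    (hε' : ∀ k, iidMean r (fun d => ((1 - T' d k.1) * τ' (d k)).trace.re) ≤ ε') :
    ∃ Φ : Code X B C M₁ M₂, Φ.avgError ρ ≤
      16 * (1 / L₁ + 1 / L₂ + K / ((L₁ : ℝ) * L₂)) + 4 * (1 - ∑ u, q u * ∑ v, r v * w u v)
        + 2 * (ε + ε') := by
  set P := ∑ u, q u * ∑ v, r v * w u v with hPdef
  have hP1 : P ≤ 1 := by
    rw [← hw.q_sum]
    exact Finset.sum_le_sum fun u _ =>
      mul_le_of_le_one_right (hw.q_nonneg u) (hw.mean_right_le u)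
  have hL₁ : (0 : ℝ) < L₁ := by exact_mod_cast Nat.pos_of_ne_zero (NeZero.ne L₁)
  have hL₂ : (0 : ℝ) < L₂ := by exact_mod_cast Nat.pos_of_ne_zero (NeZero.ne L₂)
  have hM₁ : (0 : ℝ) < M₁ := by exact_mod_cast Nat.pos_of_ne_zero (NeZero.ne M₁)
  have hM₂ : (0 : ℝ) < M₂ := by exact_mod_cast Nat.pos_of_ne_zero (NeZero.ne M₂)
  have hρ0 : ∀ x, 0 ≤ ρ x := fun x => Matrix.nonneg_iff_posSemidef.2 (hρ x).1
  -- the error for the message pair `m` if the pair `l` of bin elements is sent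
  let e : (Fin M₁ × Fin L₁ → U) → (Fin M₂ × Fin L₂ → V) → Fin M₁ × Fin M₂ → Fin L₁ × Fin L₂ → ℝ :=
    fun c d m l => ((1 - T c m.1 ⊗ₖ T' d m.2) * ρ (f (c (m.1, l.1), d (m.2, l.2)))).trace.re
  -- the likelihood ratio of the same pair of codewords
  let wt : (Fin M₁ × Fin L₁ → U) → (Fin M₂ × Fin L₂ → V) → Fin M₁ × Fin M₂ → Fin L₁ × Fin L₂ → ℝ :=
    fun c d m l => w (c (m.1, l.1)) (d (m.2, l.2))
  have he0 : ∀ c d m l, 0 ≤ e c d m l := fun c d m l =>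
    re_trace_mul_nonneg
      (sub_nonneg.2 (kronecker_le_one ((hT c).le_one _) ((hT' d).nonneg _) ((hT' d).le_one _)))
      (hρ0 _)
  have he1 : ∀ c d m l, e c d m l ≤ 1 := fun c d m l => by
    have h := re_trace_mul_le_of_le_left
      (sub_le_self 1 (kronecker_nonneg ((hT c).nonneg m.1) ((hT' d).nonneg m.2)))
      (hρ0 (f (c (m.1, l.1), d (m.2, l.2))))
    rwa [one_mul, (hρ _).2, Complex.one_re] at h
  -- the bound of `exists_cost_le` for the best pair
  let Y : (Fin M₁ × Fin L₁ → U) → (Fin M₂ × Fin L₂ → V) → Fin M₁ × Fin M₂ → ℝ := fun c d m =>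
    16 * ((∑ l₁, ∑ l₂, w (c (m.1, l₁)) (d (m.2, l₂))) / ((L₁ : ℝ) * L₂) - P) ^ 2
      + (4 * (1 - P) + 2 / ((L₁ : ℝ) * L₂) * ∑ l, wt c d m l * e c d m l)
  have hsel : ∀ c d m, ∃ l, e c d m l ≤ Y c d m := fun c d m => by
    obtain ⟨l, hl⟩ := exists_cost_le (w := wt c d m) (e := e c d m) (fun l => hw.nonneg _ _)
      (he0 c d m) (he1 c d m) hP1
    refine ⟨l, hl.trans (le_of_eq ?_)⟩
    simp only [Y, Fintype.card_prod, Fintype.card_fin, Nat.cast_mul, wt, Fintype.sum_prod_type]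
    ring
  choose l hl using hsel
  -- averaging over the codeword of the other user alone turns `w` times the output into at most `τ`
  have hB : ∀ m l, iidMean q (fun c => iidMean r fun d => wt c d m l *
      ((1 - T c m.1) * traceSnd (ρ (f (c (m.1, l.1), d (m.2, l.2))))).trace.re) ≤ ε := fun m l => by
    refine le_trans (iidMean_mono hw.q_nonneg fun c => ?_) (hε (m.1, l.1))
    rw [iidMean_eval hw.r_sum (m.2, l.2) fun v => w (c (m.1, l.1)) v *
      ((1 - T c m.1) * traceSnd (ρ (f (c (m.1, l.1), v)))).trace.re]
    have h := re_trace_mul_nonneg (sub_nonneg.2 ((hT c).le_one m.1))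
      (sub_nonneg.2 (hτ (c (m.1, l.1))))
    rw [mul_sub, Matrix.trace_sub, Complex.sub_re, sub_nonneg] at h
    refine le_trans (le_of_eq ?_) h
    simp only [Finset.mul_sum, mul_smul_comm, Matrix.trace_sum, Matrix.trace_smul,
      Complex.re_sum, Complex.smul_re, smul_eq_mul, mul_assoc]
  have hC : ∀ m l, iidMean q (fun c => iidMean r fun d => wt c d m l *
      ((1 - T' d m.2) * traceFst (ρ (f (c (m.1, l.1), d (m.2, l.2))))).trace.re) ≤ ε' :=
      fun m l => by
    rw [iidMean_comm]
    refine le_trans (iidMean_mono hw.r_nonneg fun d => ?_) (hε' (m.2, l.2))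
    rw [iidMean_eval hw.q_sum (m.1, l.1) fun u => w u (d (m.2, l.2)) *
      ((1 - T' d m.2) * traceFst (ρ (f (u, d (m.2, l.2))))).trace.re]
    have h := re_trace_mul_nonneg (sub_nonneg.2 ((hT' d).le_one m.2))
      (sub_nonneg.2 (hτ' (d (m.2, l.2))))
    rw [mul_sub, Matrix.trace_sub, Complex.sub_re, sub_nonneg] at h
    refine le_trans (le_of_eq ?_) h
    simp only [Finset.mul_sum, mul_smul_comm, Matrix.trace_sum, Matrix.trace_smul,
      Complex.re_sum, Complex.smul_re, smul_eq_mul, mul_assoc]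
  have hwe : ∀ m l, iidMean q (fun c => iidMean r fun d => wt c d m l * e c d m l) ≤ ε + ε' :=
      fun m l => by
    have hle : ∀ c d, wt c d m l * e c d m l ≤ wt c d m l *
        ((1 - T c m.1) * traceSnd (ρ (f (c (m.1, l.1), d (m.2, l.2))))).trace.re + wt c d m l *
        ((1 - T' d m.2) * traceFst (ρ (f (c (m.1, l.1), d (m.2, l.2))))).trace.re := fun c d => by
      rw [← mul_add]
      refine mul_le_mul_of_nonneg_left ?_ (hw.nonneg _ _)
      refine (re_trace_mul_le_of_le_left
        (one_sub_kronecker_le ((hT c).le_one m.1) ((hT' d).le_one m.2)) (hρ0 _)).trans (le_of_eq ?_)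
      rw [add_mul, Matrix.trace_add, Complex.add_re, trace_kronecker_one_mul,
        trace_one_kronecker_mul]
    refine (iidMean_mono hw.q_nonneg fun c => iidMean_mono hw.r_nonneg fun d => hle c d).trans ?_
    simp only [iidMean_add]
    exact add_le_add (hB m l) (hC m l)
  have hY : ∀ m, iidMean q (fun c => iidMean r fun d => Y c d m) ≤
      16 * (1 / L₁ + 1 / L₂ + K / ((L₁ : ℝ) * L₂)) + 4 * (1 - P) + 2 * (ε + ε') := fun m => by
    have h1 := hw.variance_le (a := fun l₁ : Fin L₁ => (m.1, l₁))
      (b := fun l₂ : Fin L₂ => (m.2, l₂))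
      (fun _ _ h => (Prod.mk.inj h).2) (fun _ _ h => (Prod.mk.inj h).2)
    simp only [Fintype.card_fin] at h1
    simp only [Y, iidMean_add, iidMean_const_mul, iidMean_sum, iidMean_const hw.r_sum,
      iidMean_const hw.q_sum]
    have h2 := Finset.sum_le_sum fun l (_ : l ∈ Finset.univ) => hwe m l
    rw [Finset.sum_const, Finset.card_univ, Fintype.card_prod, Fintype.card_fin, Fintype.card_fin,
      nsmul_eq_mul, Nat.cast_mul] at h2
    have h3 := mul_le_mul_of_nonneg_left h2 (by positivity : 0 ≤ 2 / ((L₁ : ℝ) * L₂))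
    have h4 : 2 / ((L₁ : ℝ) * L₂) * ((L₁ : ℝ) * L₂ * (ε + ε')) = 2 * (ε + ε') := by field_simp
    rw [h4] at h3
    linarith
  obtain ⟨c, hc⟩ := exists_le_iidMean hw.q_nonneg hw.q_sum fun c : Fin M₁ × Fin L₁ → U =>
    iidMean r fun d : Fin M₂ × Fin L₂ → V => 1 / ((M₁ : ℝ) * M₂) * ∑ m, Y c d m
  obtain ⟨d, hd⟩ := exists_le_iidMean hw.r_nonneg hw.r_sum fun d : Fin M₂ × Fin L₂ → V =>
    1 / ((M₁ : ℝ) * M₂) * ∑ m, Y c d m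
  refine ⟨⟨fun m => f (c (m.1, (l c d m).1), d (m.2, (l c d m).2)), T c, T' d, hT c, hT' d⟩, ?_⟩
  have hfin : 1 / ((M₁ : ℝ) * M₂) * ∑ m, e c d m (l c d m) ≤ 1 / ((M₁ : ℝ) * M₂) * ∑ m, Y c d m :=
    mul_le_mul_of_nonneg_left (Finset.sum_le_sum fun m _ => hl c d m) (by positivity)
  refine hfin.trans (hd.trans (hc.trans ?_))
  simp only [iidMean_const_mul, iidMean_sum]
  have h2 := Finset.sum_le_sum fun m (_ : m ∈ Finset.univ) => hY m
  rw [Finset.sum_const, Finset.card_univ, Fintype.card_prod, Fintype.card_fin, Fintype.card_fin,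
    nsmul_eq_mul, Nat.cast_mul] at h2
  have h3 := mul_le_mul_of_nonneg_left h2 (by positivity : 0 ≤ 1 / ((M₁ : ℝ) * M₂))
  refine h3.trans (le_of_eq ?_)
  field_simp

end OneShot

/-! ### The marginal classical-quantum states -/

section Ensemble

open scoped MatrixOrder

variable {A D E : Type*} [Fintype A] [Fintype D] [Fintype E]

/-- `σ` has the diagonal blocks `∑ d, p a d • θ a d` of the classical-quantum state
`∑ a d, p a d |a⟩⟨a| ⊗ θ a d`, where `θ` is a family of states and `p` is a probability mass
function. The other blocks of `σ` play no role. -/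
structure IsEnsemble (p : A → D → ℝ) (θ : A → D → Matrix E E ℂ)
    (σ : Matrix (A × E) (A × E) ℂ) : Prop where
  prob_nonneg : ∀ a d, 0 ≤ p a d
  prob_sum : ∑ a, ∑ d, p a d = 1
  state_nonneg : ∀ a d, 0 ≤ θ a d
  state_trace : ∀ a d, (θ a d).trace = 1
  block : ∀ a e e', σ (a, e) (a, e') = ∑ d, (p a d : ℂ) * θ a d e e'

variable {p : A → D → ℝ} {θ : A → D → Matrix E E ℂ} {σ : Matrix (A × E) (A × E) ℂ}

theorem IsEnsemble.cqProb_eq (h : IsEnsemble p θ σ) (a : A) : cqProb σ a = ∑ d, p a d := by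
  have h1 : ∑ e, σ (a, e) (a, e) = ∑ d, (p a d : ℂ) := by
    simp only [h.block]
    rw [Finset.sum_comm]
    refine Finset.sum_congr rfl fun d _ => ?_
    have := h.state_trace a d
    simp only [Matrix.trace, Matrix.diag_apply] at this
    rw [← Finset.mul_sum, this, mul_one]
  rw [cqProb, h1, Complex.re_sum]
  simp

theorem IsEnsemble.cqCond_eq (h : IsEnsemble p θ σ) (a : A) :
    cqCond σ a = ∑ d, ((cqProb σ a)⁻¹ * p a d) • θ a d := by
  ext e e'
  simp only [cqCond, Matrix.smul_apply, Matrix.of_apply, h.block, Matrix.sum_apply, mul_smul,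
    Finset.smul_sum]
  exact Finset.sum_congr rfl fun d _ => by rw [Complex.real_smul (x := p a d)]

theorem IsEnsemble.cqProb_nonneg (h : IsEnsemble p θ σ) (a : A) : 0 ≤ cqProb σ a := by
  rw [h.cqProb_eq]
  exact Finset.sum_nonneg fun d _ => h.prob_nonneg a d

theorem IsEnsemble.sum_cqProb (h : IsEnsemble p θ σ) : ∑ a, cqProb σ a = 1 := by
  simp only [h.cqProb_eq, h.prob_sum]

theorem IsEnsemble.cqCond_nonneg (h : IsEnsemble p θ σ) (a : A) : 0 ≤ cqCond σ a := by
  rw [h.cqCond_eq]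
  exact Finset.sum_nonneg fun d _ => smul_nonneg
    (mul_nonneg (inv_nonneg.2 (h.cqProb_nonneg a)) (h.prob_nonneg a d)) (h.state_nonneg a d)

/-- The trace is `0` instead of `1` where the probability of `a` vanishes. -/
theorem IsEnsemble.trace_cqCond_le (h : IsEnsemble p θ σ) (a : A) :
    (cqCond σ a).trace.re ≤ 1 := by
  rw [h.cqCond_eq, Matrix.trace_sum, Complex.re_sum]
  simp only [Matrix.trace_smul, h.state_trace, Complex.smul_re, Complex.one_re, smul_eq_mul,
    mul_one]
  rw [← Finset.mul_sum, ← h.cqProb_eq]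
  exact inv_mul_le_one

theorem IsEnsemble.quantumMarginal_eq (h : IsEnsemble p θ σ) :
    quantumMarginal σ = ∑ a, cqProb σ a • cqCond σ a := by
  ext e e'
  simp only [quantumMarginal, Matrix.of_apply, Matrix.sum_apply, Matrix.smul_apply, cqCond]
  refine Finset.sum_congr rfl fun a _ => ?_
  by_cases h0 : cqProb σ a = 0
  · have hp : ∀ d, p a d = 0 := fun d => by
      rw [h.cqProb_eq, Finset.sum_eq_zero_iff_of_nonneg fun d _ => h.prob_nonneg a d] at h0
      exact h0 d (Finset.mem_univ d)
    simp [h.block, hp]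
  · rw [smul_inv_smul₀ h0]

/-- The bound on the decoding error probability of the single-user random code with `M`
messages in bins of `L` codewords, for the decision threshold `t`. -/
noncomputable def decodingError [DecidableEq E] (σ : Matrix (A × E) (A × E) ℂ) (t : ℝ)
    (M L : ℕ) : ℝ :=
  if M ≤ 1 then 0 else 2 * (1 - spectralMass σ t) + 4 * ((M : ℝ) * L / t)

theorem IsEnsemble.exists_decoder [DecidableEq E] (h : IsEnsemble p θ σ) {t : ℝ} (ht : 0 < t)
    (M L : ℕ) [NeZero M] :
    ∃ T : (Fin M × Fin L → A) → Fin M → Matrix E E ℂ, (∀ c, IsPOVM (T c)) ∧ ∀ k : Fin M × Fin L,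
      iidMean (cqProb σ) (fun c => ((1 - T c k.1) * cqCond σ (c k)).trace.re)
        ≤ decodingError σ t M L := by
  have := CQBroadcast.exists_decoder (M := Fin M) (L := Fin L) h.cqProb_nonneg h.sum_cqProb
    h.cqCond_nonneg h.trace_cqCond_le h.quantumMarginal_eq ht
  simpa only [Fintype.card_fin, decodingError, spectralMass] using this

variable {U V X B C : Type*} [Fintype U] [Fintype V] [DecidableEq U] [DecidableEq V]

theorem jointState_apply (p : U × V → ℝ) (f : U × V → X) (ρ : X → Matrix (B × C) (B × C) ℂ)
    (w w' : U × V) (x x' : B × C) :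
    jointState p f ρ (w, x) (w', x') = if w = w' then (p w : ℂ) * ρ (f w) x x' else 0 := by
  rw [jointState, Matrix.sum_apply, Finset.sum_eq_single w]
  · by_cases h : w = w'
    · subst h
      simp
    · have h' : ¬(w.1 = w'.1 ∧ w.2 = w'.2) := fun h' => h (Prod.ext h'.1 h'.2)
      rw [if_neg h]
      simp only [Matrix.smul_apply, Matrix.kronecker_apply, smul_eq_mul]
      rcases not_and_or.1 h' with h' | h' <;> simp [h']
  · intro z _ hz
    have h' : ¬(z.1 = w.1 ∧ z.2 = w.2) := fun h' => hz (Prod.ext h'.1 h'.2)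
    simp only [Matrix.smul_apply, Matrix.kronecker_apply, smul_eq_mul]
    rcases not_and_or.1 h' with h' | h' <;> simp [h']
  · simp

variable [Fintype B] [Fintype C]

theorem isEnsemble_marginalUB {p : U × V → ℝ} (hp : p ∈ stdSimplex ℝ (U × V)) (f : U × V → X)
    {ρ : X → Matrix (B × C) (B × C) ℂ} (hρ : ∀ x, IsState (ρ x)) :
    IsEnsemble (fun u v => p (u, v)) (fun u v => traceSnd (ρ (f (u, v))))
      (marginalUB (jointState p f ρ)) where
  prob_nonneg u v := hp.1 (u, v)
  prob_sum := by rw [← Fintype.sum_prod_type]; exact hp.2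
  state_nonneg u v := traceSnd_nonneg (hρ _).1
  state_trace u v := by rw [trace_traceSnd, (hρ _).2]
  block u b b' := by
    simp [marginalUB, jointState_apply, traceSnd, Finset.mul_sum]

theorem isEnsemble_marginalVC {p : U × V → ℝ} (hp : p ∈ stdSimplex ℝ (U × V)) (f : U × V → X)
    {ρ : X → Matrix (B × C) (B × C) ℂ} (hρ : ∀ x, IsState (ρ x)) :
    IsEnsemble (fun v u => p (u, v)) (fun v u => traceFst (ρ (f (u, v))))
      (marginalVC (jointState p f ρ)) where
  prob_nonneg v u := hp.1 (u, v)
  prob_sum := by rw [← Fintype.sum_prod_type_right]; exact hp.2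
  state_nonneg v u := traceFst_nonneg (hρ _).1
  state_trace v u := by rw [trace_traceFst, (hρ _).2]
  block v c c' := by
    simp [marginalVC, jointState_apply, traceFst, Finset.mul_sum]

end Ensemble

/-! ### Marton coding with the truncated likelihood ratio -/

section Marton

open scoped MatrixOrder

variable {U V X B C : Type*} [Fintype U] [Fintype V] [Fintype B] [Fintype C]

/-- The likelihood ratio `p(u,v) / (p_U(u) p_V(v))`, set to zero where it exceeds `K`. -/
noncomputable def truncatedRatio (p : U × V → ℝ) (K : ℝ) (u : U) (v : V) : ℝ :=
  if p (u, v) ≤ K * ((∑ v', p (u, v')) * ∑ u', p (u', v)) then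
    p (u, v) / ((∑ v', p (u, v')) * ∑ u', p (u', v)) else 0

variable {p : U × V → ℝ}

theorem truncatedRatio_nonneg (hp : p ∈ stdSimplex ℝ (U × V)) (K : ℝ) (u : U) (v : V) :
    0 ≤ truncatedRatio p K u v := by
  unfold truncatedRatio
  split_ifs
  · exact div_nonneg (hp.1 _) (mul_nonneg (Finset.sum_nonneg fun _ _ => hp.1 _)
      (Finset.sum_nonneg fun _ _ => hp.1 _))
  · exact le_rfl

theorem truncatedRatio_le (hp : p ∈ stdSimplex ℝ (U × V)) {K : ℝ} (hK : 0 ≤ K) (u : U) (v : V) :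
    truncatedRatio p K u v ≤ K := by
  unfold truncatedRatio
  split_ifs with h
  · exact div_le_of_le_mul₀ (mul_nonneg (Finset.sum_nonneg fun _ _ => hp.1 _)
      (Finset.sum_nonneg fun _ _ => hp.1 _)) hK h
  · exact hK

theorem mul_truncatedRatio_le_left (hp : p ∈ stdSimplex ℝ (U × V)) (K : ℝ) (u : U) (v : V) :
    (∑ u', p (u', v)) * truncatedRatio p K u v ≤ (∑ v', p (u, v'))⁻¹ * p (u, v) := by
  have hU : 0 ≤ ∑ v', p (u, v') := Finset.sum_nonneg fun _ _ => hp.1 _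
  have h0 : 0 ≤ (∑ v', p (u, v'))⁻¹ * p (u, v) := mul_nonneg (inv_nonneg.2 hU) (hp.1 _)
  unfold truncatedRatio
  split_ifs
  · by_cases hV : ∑ u', p (u', v) = 0
    · rw [hV, zero_mul]; exact h0
    · exact le_of_eq (by field_simp)
  · rw [mul_zero]; exact h0

theorem mul_truncatedRatio_le_right (hp : p ∈ stdSimplex ℝ (U × V)) (K : ℝ) (u : U) (v : V) :
    (∑ v', p (u, v')) * truncatedRatio p K u v ≤ (∑ u', p (u', v))⁻¹ * p (u, v) := by
  have hV : 0 ≤ ∑ u', p (u', v) := Finset.sum_nonneg fun _ _ => hp.1 _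
  have h0 : 0 ≤ (∑ u', p (u', v))⁻¹ * p (u, v) := mul_nonneg (inv_nonneg.2 hV) (hp.1 _)
  unfold truncatedRatio
  split_ifs
  · by_cases hU : ∑ v', p (u, v') = 0
    · rw [hU, zero_mul]; exact h0
    · exact le_of_eq (by field_simp)
  · rw [mul_zero]; exact h0

theorem isLikelihoodRatio_truncatedRatio (hp : p ∈ stdSimplex ℝ (U × V)) {K : ℝ} (hK : 0 ≤ K) :
    IsLikelihoodRatio (fun u => ∑ v, p (u, v)) (fun v => ∑ u, p (u, v)) (truncatedRatio p K) K where
  q_nonneg u := Finset.sum_nonneg fun _ _ => hp.1 _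
  q_sum := by rw [← Fintype.sum_prod_type]; exact hp.2
  r_nonneg v := Finset.sum_nonneg fun _ _ => hp.1 _
  r_sum := by rw [← Fintype.sum_prod_type_right]; exact hp.2
  nonneg := truncatedRatio_nonneg hp K
  bound_nonneg := hK
  le_bound := truncatedRatio_le hp hK
  mean_right_le u := by
    refine (Finset.sum_le_sum fun v _ => mul_truncatedRatio_le_left hp K u v).trans ?_
    rw [← Finset.mul_sum]
    exact inv_mul_le_one
  mean_left_le v := by
    refine (Finset.sum_le_sum fun u _ => mul_truncatedRatio_le_right hp K u v).trans ?_
    rw [← Finset.mul_sum]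
    exact inv_mul_le_one

/-- The mass lost by the truncation is the probability that the likelihood ratio exceeds `K`. -/
theorem one_sub_mean_truncatedRatio (hp : p ∈ stdSimplex ℝ (U × V)) (K : ℝ) :
    1 - ∑ u, (∑ v, p (u, v)) * ∑ v, (∑ u', p (u', v)) * truncatedRatio p K u v
      = ∑ w : U × V, if K * ((∑ v, p (w.1, v)) * ∑ u, p (u, w.2)) < p w then p w else 0 := by
  rw [← hp.2, Fintype.sum_prod_type, Fintype.sum_prod_type, ← Finset.sum_sub_distrib]
  refine Finset.sum_congr rfl fun u _ => ?_
  rw [Finset.mul_sum, ← Finset.sum_sub_distrib]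
  refine Finset.sum_congr rfl fun v _ => ?_
  unfold truncatedRatio
  dsimp only
  by_cases h : p (u, v) ≤ K * ((∑ v', p (u, v')) * ∑ u', p (u', v))
  · rw [if_pos h, if_neg (not_lt.2 h)]
    by_cases hU : ∑ v', p (u, v') = 0
    · have := (Finset.sum_eq_zero_iff_of_nonneg fun v' _ => hp.1 (u, v')).1 hU v (Finset.mem_univ v)
      simp [this]
    by_cases hV : ∑ u', p (u', v) = 0
    · have := (Finset.sum_eq_zero_iff_of_nonneg fun u' _ => hp.1 (u', v)).1 hV u (Finset.mem_univ u)
      simp [this]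
    field_simp
    ring
  · rw [if_neg h, if_pos (not_le.1 h)]
    ring

variable [DecidableEq U] [DecidableEq V] [DecidableEq B] [DecidableEq C]

/-- One-shot Marton coding: `K` is the threshold for the likelihood ratio of the codewords, `t` and
`t'` are those of the two decoders, and each bin has `L₁` respectively `L₂` codewords. -/
theorem exists_code_avgError_le (hp : p ∈ stdSimplex ℝ (U × V)) (f : U × V → X)
    {ρ : X → Matrix (B × C) (B × C) ℂ} (hρ : ∀ x, IsState (ρ x)) {K t t' : ℝ} (hK : 0 ≤ K)
    (ht : 0 < t) (ht' : 0 < t') (M₁ M₂ L₁ L₂ : ℕ) [NeZero M₁] [NeZero M₂] [NeZero L₁] [NeZero L₂] :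
    ∃ Φ : Code X B C M₁ M₂, Φ.avgError ρ ≤
      16 * (1 / L₁ + 1 / L₂ + K / ((L₁ : ℝ) * L₂))
        + 4 * (∑ w : U × V, if K * ((∑ v, p (w.1, v)) * ∑ u, p (u, w.2)) < p w then p w else 0)
        + 2 * (decodingError (marginalUB (jointState p f ρ)) t M₁ L₁
          + decodingError (marginalVC (jointState p f ρ)) t' M₂ L₂) := by
  have hB := isEnsemble_marginalUB hp f hρ
  have hC := isEnsemble_marginalVC hp f hρ
  obtain ⟨T, hT, hTε⟩ := hB.exists_decoder ht M₁ L₁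
  obtain ⟨T', hT', hTε'⟩ := hC.exists_decoder ht' M₂ L₂
  rw [funext hB.cqProb_eq] at hTε
  rw [funext hC.cqProb_eq] at hTε'
  have hcondB : ∀ u, ∑ v, ((∑ u', p (u', v)) * truncatedRatio p K u v) • traceSnd (ρ (f (u, v)))
      ≤ cqCond (marginalUB (jointState p f ρ)) u := fun u => by
    rw [hB.cqCond_eq, hB.cqProb_eq]
    exact Finset.sum_le_sum fun v _ => smul_le_smul_of_nonneg_right
      (mul_truncatedRatio_le_left hp K u v) (hB.state_nonneg u v)
  have hcondC : ∀ v, ∑ u, ((∑ v', p (u, v')) * truncatedRatio p K u v) • traceFst (ρ (f (u, v)))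
      ≤ cqCond (marginalVC (jointState p f ρ)) v := fun v => by
    rw [hC.cqCond_eq, hC.cqProb_eq]
    exact Finset.sum_le_sum fun u _ => smul_le_smul_of_nonneg_right
      (mul_truncatedRatio_le_right hp K u v) (hC.state_nonneg v u)
  obtain ⟨Φ, hΦ⟩ := exists_code_of_decoders (isLikelihoodRatio_truncatedRatio hp hK) f hρ hcondB
    hcondC hT hT' hTε hTε'
  rw [one_sub_mean_truncatedRatio hp K] at hΦ
  exact ⟨Φ, hΦ⟩

end Marton

/-! ### Asymptotics -/

section Asymptotics

/-- Real thresholds witnessing the strict rate inequalities. -/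
theorem exists_thresholds {S S' Z : Set ℝ} {R₁ R₂ : ℝ}
    (h₁ : (R₁ : EReal) < sSup ((fun γ : ℝ => (γ : EReal)) '' S))
    (h₂ : (R₂ : EReal) < sSup ((fun γ : ℝ => (γ : EReal)) '' S'))
    (h : ((R₁ + R₂ : ℝ) : EReal) < sSup ((fun γ : ℝ => (γ : EReal)) '' S)
      + sSup ((fun γ : ℝ => (γ : EReal)) '' S') - sInf ((fun l : ℝ => (l : EReal)) '' Z)) :
    ∃ γ₁ ∈ S, ∃ γ₂ ∈ S', ∃ lam ∈ Z, R₁ < γ₁ ∧ R₂ < γ₂ ∧ R₁ + R₂ < γ₁ + γ₂ - lam := by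
  have hlt := EReal.add_lt_of_lt_sub h
  obtain ⟨a, ha, b, hb, hab⟩ : ∃ a < sSup ((fun γ : ℝ => (γ : EReal)) '' S),
      ∃ b < sSup ((fun γ : ℝ => (γ : EReal)) '' S'),
        ((R₁ + R₂ : ℝ) : EReal) + sInf ((fun l : ℝ => (l : EReal)) '' Z) < a + b := by
    by_contra! hcon
    exact absurd hlt (not_lt.2 (EReal.add_le_of_forall_lt hcon))
  obtain ⟨_, ⟨γ₁, hγ₁, rfl⟩, h1⟩ := lt_sSup_iff.1 (max_lt ha h₁)
  obtain ⟨_, ⟨γ₂, hγ₂, rfl⟩, h2⟩ := lt_sSup_iff.1 (max_lt hb h₂)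
  have h3 : ((R₁ + R₂ : ℝ) : EReal) + sInf ((fun l : ℝ => (l : EReal)) '' Z)
      < ((γ₁ + γ₂ : ℝ) : EReal) := by
    rw [EReal.coe_add γ₁]
    exact hab.trans_le (add_le_add ((le_max_left _ _).trans h1.le) ((le_max_left _ _).trans h2.le))
  have h4 : sInf ((fun l : ℝ => (l : EReal)) '' Z) < ((γ₁ + γ₂ - (R₁ + R₂) : ℝ) : EReal) := by
    rw [EReal.coe_sub, EReal.lt_sub_iff_add_lt (Or.inl (EReal.coe_ne_bot _))
      (Or.inl (EReal.coe_ne_top _)), add_comm]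
    exact h3
  obtain ⟨_, ⟨lam, hlam, rfl⟩, h5⟩ := sInf_lt_iff.1 h4
  refine ⟨γ₁, hγ₁, γ₂, hγ₂, lam, hlam, EReal.coe_lt_coe_iff.1 ((le_max_right _ _).trans_lt h1),
    EReal.coe_lt_coe_iff.1 ((le_max_right _ _).trans_lt h2), ?_⟩
  have := EReal.coe_lt_coe_iff.1 h5
  linarith

/-- The number `⌈2^(nR)⌉` of messages, or of codewords in a bin, for the rate `R`
and block length `n`. -/
noncomputable def numMessages (R : ℝ) (n : ℕ) : ℕ := ⌈(2 : ℝ) ^ ((n : ℝ) * R)⌉₊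

theorem numMessages_pos (R : ℝ) (n : ℕ) : 0 < numMessages R n :=
  Nat.ceil_pos.2 (by positivity)

instance (R : ℝ) (n : ℕ) : NeZero (numMessages R n) := ⟨(numMessages_pos R n).ne'⟩

theorem rpow_le_numMessages (R : ℝ) (n : ℕ) : (2 : ℝ) ^ ((n : ℝ) * R) ≤ numMessages R n :=
  Nat.le_ceil _

theorem numMessages_le {R : ℝ} (hR : 0 ≤ R) (n : ℕ) :
    (numMessages R n : ℝ) ≤ 2 * (2 : ℝ) ^ ((n : ℝ) * R) := by
  have h1 : (1 : ℝ) ≤ (2 : ℝ) ^ ((n : ℝ) * R) :=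
    Real.one_le_rpow one_le_two (by positivity)
  have h2 := Nat.ceil_lt_add_one (by positivity : 0 ≤ (2 : ℝ) ^ ((n : ℝ) * R))
  unfold numMessages
  linarith

theorem numMessages_le_one {R : ℝ} (hR : R ≤ 0) (n : ℕ) : numMessages R n ≤ 1 := by
  refine Nat.ceil_le.2 ?_
  rw [Nat.cast_one]
  exact Real.rpow_le_one_of_one_le_of_nonpos one_le_two
    (mul_nonpos_of_nonneg_of_nonpos n.cast_nonneg hR)

theorem le_liminf_numMessages (R : ℝ) :
    (R : EReal) ≤ liminf (fun n => ((Real.logb 2 (numMessages R n) / (n : ℝ) : ℝ) : EReal))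
      atTop := by
  refine le_liminf_of_le (by isBoundedDefault) ?_
  filter_upwards [eventually_gt_atTop 0] with n hn
  have hn' : (0 : ℝ) < n := by exact_mod_cast hn
  rw [EReal.coe_le_coe_iff, le_div_iff₀ hn',
    Real.le_logb_iff_rpow_le one_lt_two (by exact_mod_cast numMessages_pos R n), mul_comm]
  exact rpow_le_numMessages R n

theorem tendsto_two_rpow_mul_atTop {a : ℝ} (ha : a < 0) :
    Tendsto (fun n : ℕ => (2 : ℝ) ^ ((n : ℝ) * a)) atTop (𝓝 0) := by
  have h := tendsto_pow_atTop_nhds_zero_of_lt_one (r := (2 : ℝ) ^ a) (by positivity)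
    (Real.rpow_lt_one_of_one_lt_of_neg one_lt_two ha)
  refine h.congr fun n => ?_
  rw [← Real.rpow_natCast, ← Real.rpow_mul two_pos.le, mul_comm]

theorem one_div_numMessages_le (r : ℝ) (n : ℕ) :
    1 / (numMessages r n : ℝ) ≤ (2 : ℝ) ^ ((n : ℝ) * (-r)) := by
  rw [mul_neg, Real.rpow_neg two_pos.le, ← one_div]
  exact one_div_le_one_div_of_le (by positivity) (rpow_le_numMessages r n)

theorem tendsto_one_div_numMessages {r : ℝ} (hr : 0 < r) :
    Tendsto (fun n => 1 / (numMessages r n : ℝ)) atTop (𝓝 0) :=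
  squeeze_zero (fun n => by positivity) (one_div_numMessages_le r)
    (tendsto_two_rpow_mul_atTop (neg_lt_zero.2 hr))

theorem tendsto_rpow_div_numMessages {r₁ r₂ lam : ℝ} (h : lam < r₁ + r₂) :
    Tendsto (fun n : ℕ => (2 : ℝ) ^ ((n : ℝ) * lam)
      / ((numMessages r₁ n : ℝ) * numMessages r₂ n)) atTop (𝓝 0) := by
  refine squeeze_zero (fun n => by positivity) (fun n => ?_)
    (tendsto_two_rpow_mul_atTop (a := lam - r₁ - r₂) (by linarith))
  have e : (n : ℝ) * (lam - r₁ - r₂) = n * lam + (n * (-r₁) + n * (-r₂)) := by ring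
  rw [e, Real.rpow_add two_pos, Real.rpow_add two_pos, ← mul_one_div,
    ← one_div_mul_one_div]
  refine mul_le_mul_of_nonneg_left ?_ (by positivity)
  exact mul_le_mul (one_div_numMessages_le r₁ n) (one_div_numMessages_le r₂ n) (by positivity)
    (by positivity)

/-- The bound on the decoding error vanishes below the threshold rate `γ`. For `R ≤ 0` there is a
single message, so that `r` may exceed `γ`. -/
theorem tendsto_decodingError {U B : Type*} [Fintype U] [Fintype B] [DecidableEq B]
    {σ : ∀ n : ℕ, Matrix ((Fin n → U) × (Fin n → B)) ((Fin n → U) × (Fin n → B)) ℂ}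
    {R r γ : ℝ} (hr : 0 ≤ r) (hRr : R + r < γ)
    (hγ : Tendsto (fun n : ℕ => spectralMass (σ n) ((2 : ℝ) ^ ((n : ℝ) * γ))) atTop (𝓝 1)) :
    Tendsto (fun n : ℕ => decodingError (σ n) ((2 : ℝ) ^ ((n : ℝ) * γ)) (numMessages R n)
      (numMessages r n)) atTop (𝓝 0) := by
  rcases le_or_gt R 0 with hR | hR
  · simp only [decodingError, if_pos (numMessages_le_one hR _)]
    exact tendsto_const_nhds
  have hq : Tendsto (fun n : ℕ => (numMessages R n : ℝ) * numMessages r n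
      / (2 : ℝ) ^ ((n : ℝ) * γ)) atTop (𝓝 0) := by
    have h0 := (tendsto_two_rpow_mul_atTop (a := R + r - γ) (by linarith)).const_mul 4
    rw [mul_zero] at h0
    refine squeeze_zero (fun n => by positivity) (fun n => ?_) h0
    have e : (n : ℝ) * (R + r - γ) = n * R + n * r - n * γ := by ring
    rw [e, Real.rpow_sub two_pos, Real.rpow_add two_pos, mul_div_assoc']
    refine div_le_div_of_nonneg_right ?_ (by positivity)
    have := mul_le_mul (numMessages_le hR.le n) (numMessages_le hr n) (by positivity)
      (by positivity)
    linarith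
  have hlim : Tendsto (fun n : ℕ => 2 * |1 - spectralMass (σ n) ((2 : ℝ) ^ ((n : ℝ) * γ))|
      + 4 * ((numMessages R n : ℝ) * numMessages r n / (2 : ℝ) ^ ((n : ℝ) * γ))) atTop (𝓝 0) := by
    have := ((hγ.const_sub 1).abs.const_mul 2).add (hq.const_mul 4)
    simpa using this
  refine squeeze_zero_norm (fun n => ?_) hlim
  unfold decodingError
  rw [Real.norm_eq_abs]
  split_ifs
  · rw [abs_zero]; positivity
  · refine (abs_add_le _ _).trans (le_of_eq ?_)
    rw [abs_mul, abs_two, abs_of_nonneg (by positivity : 0 ≤ 4 * ((numMessages R n : ℝ) *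
      numMessages r n / (2 : ℝ) ^ ((n : ℝ) * γ)))]

theorem lt_infoDensity_of_lt {U V : Type*} [Fintype U] [Fintype V] {p : U × V → ℝ}
    (hp : p ∈ stdSimplex ℝ (U × V)) {n : ℕ} (hn : 0 < n) {lam : ℝ} {w : U × V}
    (h : (2 : ℝ) ^ ((n : ℝ) * lam) * ((∑ v, p (w.1, v)) * ∑ u, p (u, w.2)) < p w) :
    lam < 1 / (n : ℝ) * infoDensity p w := by
  have hn' : (0 : ℝ) < n := by exact_mod_cast hn
  have hU : 0 ≤ ∑ v, p (w.1, v) := Finset.sum_nonneg fun _ _ => hp.1 _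
  have hV : 0 ≤ ∑ u, p (u, w.2) := Finset.sum_nonneg fun _ _ => hp.1 _
  have hw : 0 < p w := lt_of_le_of_lt (by positivity) h
  have hU' : 0 < ∑ v, p (w.1, v) := hw.trans_le
    (Finset.single_le_sum (f := fun v => p (w.1, v)) (fun _ _ => hp.1 _) (Finset.mem_univ w.2))
  have hV' : 0 < ∑ u, p (u, w.2) := hw.trans_le
    (Finset.single_le_sum (f := fun u => p (u, w.2)) (fun _ _ => hp.1 _) (Finset.mem_univ w.1))
  have hlog : (n : ℝ) * lam < infoDensity p w := by
    rw [infoDensity, Real.lt_logb_iff_rpow_lt one_lt_two (by positivity),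
      lt_div_iff₀ (by positivity)]
    exact h
  rw [one_div_mul_eq_div, lt_div_iff₀ hn', mul_comm]
  exact hlog

theorem Code.avgError_nonneg {X B C : Type*} [Fintype B] [Fintype C] [DecidableEq B]
    [DecidableEq C] {M₁ M₂ : ℕ} (Φ : Code X B C M₁ M₂) {ρ : X → Matrix (B × C) (B × C) ℂ}
    (hρ : ∀ x, IsState (ρ x)) : 0 ≤ Φ.avgError ρ := by
  open scoped MatrixOrder in
  refine mul_nonneg (by positivity) (Finset.sum_nonneg fun m _ => re_trace_mul_nonneg
    (sub_nonneg.2 (kronecker_le_one (Φ.povmB.le_one _) (Φ.povmC.nonneg _) (Φ.povmC.le_one _)))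
    (Matrix.nonneg_iff_posSemidef.2 (hρ _).1))

end Asymptotics

end CQBroadcast

theorem mainTheorem3 {𝒰 𝒱 𝒳 ℬ 𝒞 : Type*} [Fintype 𝒰] [Fintype 𝒱] [Fintype 𝒳] [Fintype ℬ]
    [Fintype 𝒞] [DecidableEq 𝒰] [DecidableEq 𝒱] [DecidableEq ℬ] [DecidableEq 𝒞]
    (ρ : ∀ n : ℕ, (Fin n → 𝒳) →
      Matrix ((Fin n → ℬ) × (Fin n → 𝒞)) ((Fin n → ℬ) × (Fin n → 𝒞)) ℂ)
    (hρ : ∀ n x, CQBroadcast.IsState (ρ n x))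
    (p : ∀ n : ℕ, (Fin n → 𝒰) × (Fin n → 𝒱) → ℝ)
    (hp : ∀ n, p n ∈ stdSimplex ℝ ((Fin n → 𝒰) × (Fin n → 𝒱)))
    (f : ∀ n : ℕ, (Fin n → 𝒰) × (Fin n → 𝒱) → (Fin n → 𝒳))
    (R₁ R₂ : ℝ)
    (hR₁ : (R₁ : EReal) < CQBroadcast.spectralInfRate
      (fun n => CQBroadcast.marginalUB (CQBroadcast.jointState (p n) (f n) (ρ n))))
    (hR₂ : (R₂ : EReal) < CQBroadcast.spectralInfRate
      (fun n => CQBroadcast.marginalVC (CQBroadcast.jointState (p n) (f n) (ρ n))))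
    (hR : ((R₁ + R₂ : ℝ) : EReal) <
      CQBroadcast.spectralInfRate
          (fun n => CQBroadcast.marginalUB (CQBroadcast.jointState (p n) (f n) (ρ n)))
        + CQBroadcast.spectralInfRate
          (fun n => CQBroadcast.marginalVC (CQBroadcast.jointState (p n) (f n) (ρ n)))
        - CQBroadcast.spectralSupRate p) :
    CQBroadcast.AsymptoticallyAchievable ρ R₁ R₂ := by
  open CQBroadcast in
  obtain ⟨γ₁, hγ₁, γ₂, hγ₂, lam, hlam, h₁, h₂, h⟩ := exists_thresholds hR₁ hR₂ hR
  rw [Set.mem_ofPred_eq] at hγ₁ hγ₂ hlam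
  -- bin rates `r₁`, `r₂` filling up `γ₁ - R₁` and `γ₂ - R₂` except for a small `ε`
  obtain ⟨ε, hε, hε₁, hε₂, hε₃⟩ : ∃ ε : ℝ, 0 < ε ∧ ε < γ₁ - R₁ ∧ ε < γ₂ - R₂ ∧
      2 * ε < γ₁ + γ₂ - lam - (R₁ + R₂) := by
    have hmin : 0 < min (min (γ₁ - R₁) (γ₂ - R₂)) (γ₁ + γ₂ - lam - (R₁ + R₂)) :=
      lt_min (lt_min (by linarith) (by linarith)) (by linarith)
    have a1 := min_le_left (min (γ₁ - R₁) (γ₂ - R₂)) (γ₁ + γ₂ - lam - (R₁ + R₂))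
    have a2 := min_le_right (min (γ₁ - R₁) (γ₂ - R₂)) (γ₁ + γ₂ - lam - (R₁ + R₂))
    have a3 := min_le_left (γ₁ - R₁) (γ₂ - R₂)
    have a4 := min_le_right (γ₁ - R₁) (γ₂ - R₂)
    refine ⟨min (min (γ₁ - R₁) (γ₂ - R₂)) (γ₁ + γ₂ - lam - (R₁ + R₂)) / 3, ?_, ?_, ?_, ?_⟩ <;>
      linarith
  obtain ⟨r₁, hr₁⟩ : ∃ r₁, r₁ = γ₁ - R₁ - ε := ⟨_, rfl⟩
  obtain ⟨r₂, hr₂⟩ : ∃ r₂, r₂ = γ₂ - R₂ - ε := ⟨_, rfl⟩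
  have hcode := fun n => exists_code_avgError_le (hp n) (f n) (hρ n)
    (K := (2 : ℝ) ^ ((n : ℝ) * lam)) (t := (2 : ℝ) ^ ((n : ℝ) * γ₁))
    (t' := (2 : ℝ) ^ ((n : ℝ) * γ₂)) (by positivity) (by positivity) (by positivity)
    (numMessages R₁ n) (numMessages R₂ n) (numMessages r₁ n) (numMessages r₂ n)
  choose Φ hΦ using hcode
  refine ⟨numMessages R₁, numMessages R₂, Φ, numMessages_pos R₁, numMessages_pos R₂,
    le_liminf_numMessages R₁, le_liminf_numMessages R₂, ?_⟩
  have hatyp : Tendsto (fun n => ∑ w : (Fin n → 𝒰) × (Fin n → 𝒱),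
      if (2 : ℝ) ^ ((n : ℝ) * lam) * ((∑ v, p n (w.1, v)) * ∑ u, p n (u, w.2)) < p n w
        then p n w else 0) atTop (𝓝 0) := by
    refine squeeze_zero' (Eventually.of_forall fun n => Finset.sum_nonneg fun w _ => ?_) ?_ hlam
    · split_ifs
      exacts [(hp n).1 w, le_rfl]
    · filter_upwards [eventually_gt_atTop 0] with n hn
      refine Finset.sum_le_sum fun w _ => ?_
      split_ifs with c1 c2 c2
      · exact le_rfl
      · exact absurd (lt_infoDensity_of_lt (hp n) hn c1) c2
      · exact (hp n).1 w
      · exact le_rfl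
  have hlim := (((tendsto_one_div_numMessages (r := r₁) (by linarith)).add
    (tendsto_one_div_numMessages (r := r₂) (by linarith))).add
    (tendsto_rpow_div_numMessages (r₁ := r₁) (r₂ := r₂) (lam := lam) (by linarith))).const_mul 16
    |>.add (hatyp.const_mul 4) |>.add
    (((tendsto_decodingError (R := R₁) (r := r₁) (by linarith) (by linarith) hγ₁).add
      (tendsto_decodingError (R := R₂) (r := r₂) (by linarith) (by linarith) hγ₂)).const_mul 2)
  simp only [add_zero, mul_zero] at hlim
  exact squeeze_zero (fun n => (Φ n).avgError_nonneg (hρ n)) hΦ hlim
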